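/- Let $\Omega\subset\mathbb R^d$ ($d\ge1$) be a bounded open set (for instance a bounded connected domain with smooth boundary) and let $(\phi_j)_{j\ge1}$ be an orthonormal basis of $L^2(\Omega)$ of (weak, $H^1_0$) eigenfunctions of $-\Delta$ with zero Dirichlet condition, with eigenvalues $\lambda_1\le\lambda_2\le\dots$. Let $T>0$ and let $F:\Omega\times[0,T]\times\mathbb R\to\mathbb R$, $F=F(x,t,z)$, be measurable in $(x,t)$, with $|F(x,t,z)-F(x,t,z')|\le k|z-z'|$ for all $x,t,z,z'$ ($k\ge0$) and $F(\cdot,\cdot,0)\in L^2(\Omega\times(0,T))$; write $F(v(s))=F(\cdot,s,v(s)(\cdot))$. Let $g\in L^2(\Omega)$ and let $\xi$ be a Gaussian white noise on $L^2(\Omega)$, i.e. a bounded linear map $\chi\mapsto\langle\xi,\chi\rangle$ from $L^2(\Omega)$ to the square integrable random variables with $\langle\xi,\chi\rangle\sim\mathcal N(0,\|\chi\|^2)$ and $\mathbf E\langle\xi,\chi_1\rangle\langle\xi,\chi_2\rangle=\langle\chi_1,\chi_2\rangle$. For $\delta>0$ let $N(\delta)\in\mathbb N$ and $\alpha(\delta)\in\mathbb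 R$, and set $$\overline G_\delta=\sum_{j=1}^{N(\delta)}\big(\langle g,\phi_j\rangle+\delta\langle\xi,\phi_j\rangle\big)\phi_j,\qquad J_\alpha v=\sum_{\lambda_j\le\alpha}\langle v,\phi_j\rangle\phi_j .$$ A mild solution of $v_t-\Delta v=Q(t,v)$ in $\Omega\times(0,T)$, $v|_{\partial\Omega}=0$, $v(T)=h$ is a $v\in C([0,T];L^2(\Omega))$ with $$v(t)=\sum_{j\ge1}\Big[e^{(T-t)\lambda_j}\langle h,\phi_j\rangle-\int_t^Te^{(s-t)\lambda_j}\langle Q(s,v(s)),\phi_j\rangle\,ds\Big]\phi_j\quad\text{in }L^2(\Omega),\ t\in[0,T].$$ (1) For every $\delta>0$ and every realization of the noise, the regularized problem $$v_t-\Delta v=J_{\alpha(\delta)}F(x,t,v),\qquad v|_{\partial\Omega}=0,\qquad v(T)=J_{\alpha(\delta)}\overline G_\delta$$ has a unique mild solution $u^\delta\in C([0,T];L^2(\Omega))$, and for $t\in[0,T]$ $$u^\delta(t)=\sum_{\lambda_j\le\alpha(\delta)}\Big[e^{(T-t)\lambda_j}\langle\overline G_\delta,\phi_j\rangle-\int_t^Te^{(s-t)\lambda_j}\langle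 F(u^\delta(s)),\phi_j\rangle\,ds\Big]\phi_j .$$ (2) Let $u$ be a mild solution of $u_t-\Delta u=F(x,t,u)$, $u|_{\partial\Omega}=0$, $u(T)=g$, let $\beta,\gamma\ge0$, assume $\|g\|_{H^{2\gamma}}^2:=\sum_j\lambda_j^{2\gamma}\langle g,\phi_j\rangle^2<\infty$ and $$\sum_{j=1}^\infty\lambda_j^{2\beta}e^{2t\lambda_j}\langle u(t),\phi_j\rangle^2<A'\qquad\text{for all }t\in[0,T].$$ Then for every $\delta>0$ with $N(\delta)\ge1$ and $\alpha(\delta)>0$, and every $t\in[0,T]$, $u^\delta(t)$ is a square integrable random element of $L^2(\Omega)$ and $$\mathbf E\|u(t)-u^\delta(t)\|_{L^2(\Omega)}^2\le 2e^{2k^2T(T-t)}e^{-2t\alpha(\delta)}\Big[\delta^2N(\delta)e^{2T\alpha(\delta)}+\frac{e^{2T\alpha(\delta)}}{\lambda_{N(\delta)}^{2\gamma}}\|g\|_{H^{2\gamma}}^2+A'\alpha(\delta)^{-2\beta}\Big].$$ In particular, if $$\lim_{\delta\to0^+}\alpha(\delta)=+\infty,\qquad\lim_{\delta\to0^+}\frac{e^{kT\alpha(\delta)}}{\lambda_{N(\delta)}^{\gamma}}=0,\qquad\lim_{\delta\to0^+}e^{kT\alpha(\delta)}\sqrt{N(\delta)}\,\delta=0,$$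 then for all sufficiently small $\delta>0$ one has $N(\delta)\ge1$, $\alpha(\delta)>0$, and the estimate holds for all $t\in[0,T]$. -/

import Mathlib

open MeasureTheory ProbabilityTheory Filter Topology Set
open scoped NNReal ENNReal RealInnerProductSpace

noncomputable section

namespace BackwardHeat

/-- The space `L²(Ω)` of an open set `Ω ⊆ ℝ^d`, with Lebesgue measure. -/
abbrev L2 {d : ℕ} (Ω : Set (EuclideanSpace ℝ (Fin d))) : Type :=
  Lp ℝ 2 (volume.restrict Ω)

/-- Test functions: smooth functions with compact support in `Ω`. -/
def IsTestFunction {d : ℕ} (Ω : Set (EuclideanSpace ℝ (Fin d)))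
    (f : EuclideanSpace ℝ (Fin d) → ℝ) : Prop :=
  ContDiff ℝ (⊤ : ℕ∞) f ∧ HasCompactSupport f ∧ tsupport f ⊆ Ω

/-- `v ∈ H¹₀(Ω)` with weak gradient `w`: the pair `(v, w)` is the limit in `L²(Ω)` of
`(f n, ∇ (f n))` for a sequence of test functions `f n`. -/
def IsH10WithGradient {d : ℕ} (Ω : Set (EuclideanSpace ℝ (Fin d)))
    (v : EuclideanSpace ℝ (Fin d) → ℝ)
    (w : EuclideanSpace ℝ (Fin d) → EuclideanSpace ℝ (Fin d)) : Prop :=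
  MemLp v 2 (volume.restrict Ω) ∧ MemLp w 2 (volume.restrict Ω) ∧
    ∃ f : ℕ → EuclideanSpace ℝ (Fin d) → ℝ, (∀ n, IsTestFunction Ω (f n)) ∧
      Tendsto (fun n => eLpNorm (fun x => f n x - v x) 2 (volume.restrict Ω)) atTop (𝓝 0) ∧
      Tendsto (fun n => eLpNorm (fun x => gradient (f n) x - w x) 2 (volume.restrict Ω))
        atTop (𝓝 0)

/-- Weak form of `-Δ v = μ v` in `Ω`, `v = 0` on `∂Ω`. -/
def SolvesDirichletEigenproblem {d : ℕ} (Ω : Set (EuclideanSpace ℝ (Fin d))) (μ : ℝ)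
    (v : EuclideanSpace ℝ (Fin d) → ℝ) : Prop :=
  ∃ w : EuclideanSpace ℝ (Fin d) → EuclideanSpace ℝ (Fin d), IsH10WithGradient Ω v w ∧
    ∀ ψ : EuclideanSpace ℝ (Fin d) → ℝ, IsTestFunction Ω ψ →
      ∫ x in Ω, ⟪w x, gradient ψ x⟫ = μ * ∫ x in Ω, v x * ψ x

/-- `φ 0, φ 1, …` is an orthonormal basis of `L²(Ω)` of Dirichlet eigenfunctions, listed with
nondecreasing eigenvalues `lam 0 ≤ lam 1 ≤ …` (numbering from `0`: the usual `λ_j`, `φ_j`,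
`j ≥ 1`, are `lam (j - 1)`, `φ (j - 1)`). -/
structure IsDirichletEigenbasis {d : ℕ} (Ω : Set (EuclideanSpace ℝ (Fin d))) (lam : ℕ → ℝ)
    (φ : HilbertBasis ℕ ℝ (L2 Ω)) : Prop where
  mono : Monotone lam
  eigen : ∀ j, SolvesDirichletEigenproblem Ω (lam j) (φ j)

/-- Gaussian white noise on a Hilbert space `H`: a Hilbert-space process `ξ : H → L²(P)` with
`⟨ξ, χ⟩ ∼ N(0, ‖χ‖²)` and `E (⟨ξ, χ₁⟩ ⟨ξ, χ₂⟩) = ⟨χ₁, χ₂⟩`. -/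
structure IsGaussianWhiteNoise {H S : Type*} [NormedAddCommGroup H] [InnerProductSpace ℝ H]
    [MeasurableSpace S] (P : Measure S) (ξ : H →L[ℝ] Lp ℝ 2 P) : Prop where
  law : ∀ χ : H, P.map (ξ χ) = gaussianReal 0 (‖χ‖₊ ^ 2)
  cov : ∀ χ₁ χ₂ : H, ∫ ω, ξ χ₁ ω * ξ χ₂ ω ∂P = ⟪χ₁, χ₂⟫

/-- The observation `⟨g_δ, χ⟩ = ⟨g, χ⟩ + δ ⟨ξ, χ⟩`. -/
def observation {H S : Type*} [NormedAddCommGroup H] [InnerProductSpace ℝ H]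
    [MeasurableSpace S] {P : Measure S} (ξ : H →L[ℝ] Lp ℝ 2 P) (g : H) (δ : ℝ) (χ : H)
    (ω : S) : ℝ :=
  ⟪g, χ⟫ + δ * ξ χ ω

/-- The data reconstructed from the first `N` observations, `∑_{j=1}^N ⟨g_δ, φ_j⟩ φ_j`. -/
def observedData {H S : Type*} [NormedAddCommGroup H] [InnerProductSpace ℝ H]
    [MeasurableSpace S] {P : Measure S} (φ : HilbertBasis ℕ ℝ H) (ξ : H →L[ℝ] Lp ℝ 2 P)
    (g : H) (δ : ℝ) (N : ℕ) (ω : S) : H :=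
  ∑ j ∈ Finset.range N, observation ξ g δ (φ j) ω • φ j

open Classical in
/-- The truncation `J_α v = ∑_{λ_j ≤ α} ⟨v, φ_j⟩ φ_j` (an unconditionally convergent series). -/
def truncation {H : Type*} [NormedAddCommGroup H] [InnerProductSpace ℝ H]
    (lam : ℕ → ℝ) (φ : HilbertBasis ℕ ℝ H) (α : ℝ) (v : H) : H :=
  ∑' j, if lam j ≤ α then ⟪v, φ j⟫ • φ j else 0

open Classical in
/-- The superposition `x ↦ F (x, s, w x)` as an element of `L²(Ω)` (and `0` for the exceptional
times `s`, a null set under the hypotheses of the theorem, where it is not square integrable). -/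
def superposition {d : ℕ} (Ω : Set (EuclideanSpace ℝ (Fin d)))
    (F : EuclideanSpace ℝ (Fin d) → ℝ → ℝ → ℝ) (s : ℝ) (w : L2 Ω) : L2 Ω :=
  if h : MemLp (fun x => F x s (w x)) 2 (volume.restrict Ω) then h.toLp _ else 0

/-- The coefficient `e^{(T-t)λ_j} ⟨h, φ_j⟩ - ∫_t^T e^{(s-t)λ_j} ⟨Q (s, v s), φ_j⟩ ds`. -/
def mildCoeff {H : Type*} [NormedAddCommGroup H] [InnerProductSpace ℝ H]
    (T : ℝ) (lam : ℕ → ℝ) (φ : HilbertBasis ℕ ℝ H) (Q : ℝ → H → H) (h : H) (v : ℝ → H)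
    (t : ℝ) (j : ℕ) : ℝ :=
  Real.exp ((T - t) * lam j) * ⟪h, φ j⟫
    - ∫ s in t..T, Real.exp ((s - t) * lam j) * ⟪Q s (v s), φ j⟫

/-- `v ∈ C([0,T]; H)` is a mild solution of `v_t - Δ v = Q (t, v)`, `v (T) = h`, where `-Δ` has
eigenpairs `(lam j, φ j)`. Values of `v` outside `[0,T]` are irrelevant. -/
def IsMildSolution {H : Type*} [NormedAddCommGroup H] [InnerProductSpace ℝ H]
    (T : ℝ) (lam : ℕ → ℝ) (φ : HilbertBasis ℕ ℝ H) (Q : ℝ → H → H) (h : H)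
    (v : ℝ → H) : Prop :=
  ContinuousOn v (Icc 0 T) ∧
    ∀ t ∈ Icc 0 T, HasSum (fun j => mildCoeff T lam φ Q h v t j • φ j) (v t)

/-- Mild solutions of the truncated problem
`v_t - Δ v = J_α F (x, t, v)`, `v (T) = J_α G`. -/
def IsRegularizedSolution {d : ℕ} {Ω : Set (EuclideanSpace ℝ (Fin d))} (T : ℝ)
    (lam : ℕ → ℝ) (φ : HilbertBasis ℕ ℝ (L2 Ω))
    (F : EuclideanSpace ℝ (Fin d) → ℝ → ℝ → ℝ) (α : ℝ) (G : L2 Ω) (v : ℝ → L2 Ω) : Prop :=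
  IsMildSolution T lam φ (fun s w => truncation lam φ α (superposition Ω F s w))
    (truncation lam φ α G) v

/-- `v ∈ H^p`, that is `∑ λ_j^p ⟨v, φ_j⟩² < ∞`. -/
def MemSobolev {H : Type*} [NormedAddCommGroup H] [InnerProductSpace ℝ H]
    (lam : ℕ → ℝ) (φ : HilbertBasis ℕ ℝ H) (p : ℝ) (v : H) : Prop :=
  Summable fun j => lam j ^ p * ⟪v, φ j⟫ ^ 2

/-- The squared norm `‖v‖²_{H^p} = ∑ λ_j^p ⟨v, φ_j⟩²`. -/
def sobolevNormSq {H : Type*} [NormedAddCommGroup H] [InnerProductSpace ℝ H]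
    (lam : ℕ → ℝ) (φ : HilbertBasis ℕ ℝ H) (p : ℝ) (v : H) : ℝ :=
  ∑' j, lam j ^ p * ⟪v, φ j⟫ ^ 2

/-- `2 e^{2k²T(T-t)} e^{-2tα} [δ² N e^{2Tα} + e^{2Tα} λ_N^{-2γ} ‖g‖²_{H^{2γ}} + A α^{-2β}]`;
`lamN` stands for `λ_N` and `gSq` for `‖g‖²_{H^{2γ}}`. -/
def errorBound (k T t δ A β γ : ℝ) (N : ℕ) (lamN α gSq : ℝ) : ℝ :=
  2 * Real.exp (2 * k ^ 2 * T * (T - t)) * Real.exp (-2 * t * α) *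
    (δ ^ 2 * N * Real.exp (2 * T * α)
      + Real.exp (2 * T * α) / lamN ^ (2 * γ) * gSq
      + A * α ^ (-2 * β))

end BackwardHeat

end

open BackwardHeat

/-! Modulo positivity of the eigenvalues, everything happens in an abstract Hilbert space with basis
`φ j` and a Lipschitz source `Q`. On the modes `lam j ≤ α` the backward heat group is bounded, by
`e^{tα}` for `t ≥ 0`, so the truncated problem is a Volterra equation with Lipschitz source, solved
by a contraction (`exists_solution_volterra`).

The error `u - v` splits orthogonally. The part of `u` above `α` is controlled by the weighted bound
`A` (`exp_mul_norm_sub_truncatedGroup_sq_le`). The part below satisfies the difference of the two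
mild equations; the weight `e^{tα}` cancels the kernel `e^{(s-t)α}` and leaves `e^{Tα}‖g - G‖ + k ∫
e^{sα}‖u - v‖`. Squaring, Cauchy-Schwarz and Grönwall yield the pathwise estimate
`exp_mul_norm_sub_sq_le`.

That estimate, applied to two truncated solutions, also gives uniqueness and Lipschitz dependence on
the data, hence measurability in the noise. Taking expectations leaves `E‖g - G‖²`, which by
Parseval is `δ²N` plus the tail of `g`.

Two facts feed this scheme: eigenvalues are positive by Poincaré, and superposition with `F` is
Lipschitz on `L²(Ω)` and integrable along continuous curves. -/

namespace BackwardHeat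

/-! ### Grönwall, Cauchy-Schwarz and Volterra equations -/

/-- Backward Grönwall inequality in integral form. -/
theorem le_mul_exp_of_le_add_integral {T B K : ℝ} {y : ℝ → ℝ}
    (hK : 0 ≤ K) (hy : ContinuousOn y (Icc 0 T))
    (h : ∀ t ∈ Icc 0 T, y t ≤ B + K * ∫ s in t..T, y s) {t : ℝ} (ht : t ∈ Icc 0 T) :
    y t ≤ B * Real.exp (K * (T - t)) := by
  have hT : (0 : ℝ) ≤ T := ht.1.trans ht.2
  set Y : ℝ → ℝ := IccExtend hT (fun s => y s) with hY
  have hYc : Continuous Y := (continuousOn_iff_continuous_domRestrict.1 hy).Icc_extend'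
  have hYy : ∀ s ∈ Icc 0 T, Y s = y s := fun s hs => IccExtend_of_mem hT _ hs
  have hint : ∀ r ∈ Icc 0 T, ∫ s in r..T, y s = ∫ s in r..T, Y s := by
    intro r hr
    refine intervalIntegral.integral_congr fun s hs => ?_
    rw [uIcc_of_le hr.2] at hs
    exact (hYy s ⟨hr.1.trans hs.1, hs.2⟩).symm
  -- Integrating factor: the hypothesis makes `z' ≥ 0`, and `z T = e^{KT} B`. The continuous
  -- extension `Y` allows differentiation at every point.
  set z : ℝ → ℝ := fun r => Real.exp (K * r) * (B + K * ∫ s in r..T, Y s) with hz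
  have hder : ∀ r, HasDerivAt z
      (Real.exp (K * r) * K * (B + K * ∫ s in r..T, Y s) + Real.exp (K * r) * (K * -Y r)) r := by
    intro r
    have h1 : HasDerivAt (fun r : ℝ => Real.exp (K * r)) (Real.exp (K * r) * K) r := by
      simpa using ((hasDerivAt_id r).const_mul K).exp
    have h2 := intervalIntegral.integral_hasDerivAt_left (hYc.intervalIntegrable r T)
      hYc.aestronglyMeasurable.stronglyMeasurableAtFilter hYc.continuousAt
    exact h1.mul ((h2.const_mul K).const_add B)
  have hmono : MonotoneOn z (Icc 0 T) := by
    refine monotoneOn_of_deriv_nonneg (convex_Icc 0 T)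
      (fun r _ => (hder r).continuousAt.continuousWithinAt)
      (fun r _ => (hder r).differentiableAt.differentiableWithinAt) fun r hr => ?_
    rw [interior_Icc] at hr
    have hr' : r ∈ Icc 0 T := Ioo_subset_Icc_self hr
    rw [(hder r).deriv]
    have := h r hr'
    rw [hint r hr', ← hYy r hr'] at this
    have h3 := mul_nonneg (mul_nonneg (Real.exp_pos (K * r)).le hK) (sub_nonneg.2 this)
    linarith
  have h1 := hmono ht ⟨hT, le_rfl⟩ ht.2
  simp only [hz, intervalIntegral.integral_same, mul_zero, add_zero] at h1
  have h2 := h t ht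
  rw [hint t ht] at h2
  have h3 : B + K * ∫ s in t..T, Y s ≤ Real.exp (K * T) * B / Real.exp (K * t) := by
    rw [le_div_iff₀ (Real.exp_pos _)]; linarith
  calc y t ≤ _ := h2
    _ ≤ _ := h3
    _ = B * Real.exp (K * (T - t)) := by
      rw [mul_sub, Real.exp_sub]; ring

/-- Cauchy-Schwarz, from nonnegativity of the integrated square of `(b - a) f - ∫ f`. -/
theorem sq_intervalIntegral_le {a b : ℝ} (hab : a ≤ b) {f : ℝ → ℝ}
    (hf : ContinuousOn f (Icc a b)) :
    (∫ s in a..b, f s) ^ 2 ≤ (b - a) * ∫ s in a..b, f s ^ 2 := by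
  rcases hab.eq_or_lt with rfl | hlt
  · simp
  have hf1 : IntervalIntegrable f volume a b := hf.intervalIntegrable_of_Icc hab
  have hf2 : IntervalIntegrable (fun s => f s ^ 2) volume a b :=
    (hf.pow 2).intervalIntegrable_of_Icc hab
  set I := ∫ s in a..b, f s
  have hL : 0 < b - a := sub_pos.2 hlt
  have h0 : 0 ≤ ∫ s in a..b, ((b - a) * f s - I) ^ 2 :=
    intervalIntegral.integral_nonneg hab fun s _ => sq_nonneg _
  have h1 : ∫ s in a..b, ((b - a) * f s - I) ^ 2
      = (b - a) ^ 2 * (∫ s in a..b, f s ^ 2) - (b - a) * I ^ 2 := by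
    have : ∀ s, ((b - a) * f s - I) ^ 2
        = ((b - a) ^ 2 * f s ^ 2 - 2 * (b - a) * I * f s) + I ^ 2 := fun s => by ring
    simp_rw [this]
    rw [intervalIntegral.integral_add ((hf2.const_mul _).sub (hf1.const_mul _))
        intervalIntegrable_const,
      intervalIntegral.integral_sub (hf2.const_mul _) (hf1.const_mul _),
      intervalIntegral.integral_const_mul, intervalIntegral.integral_const_mul,
      intervalIntegral.integral_const]
    simp only [smul_eq_mul]
    ring
  rw [h1] at h0
  have h2 : 0 ≤ (b - a) * ((b - a) * (∫ s in a..b, f s ^ 2) - I ^ 2) := by linarith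
  have := nonneg_of_mul_nonneg_right h2 hL
  linarith

/-- Solvability of `y t = h - ∫_t^T f s (y s) ds` for `f` integrable along continuous curves and
Lipschitz in the second variable. -/
theorem exists_solution_volterra {X : Type*} [NormedAddCommGroup X] [NormedSpace ℝ X]
    [CompleteSpace X] {T K : ℝ} (hT : 0 ≤ T) (hK : 0 ≤ K) (f : ℝ → X → X)
    (hLip : ∀ s ∈ Icc 0 T, ∀ w w', ‖f s w - f s w'‖ ≤ K * ‖w - w'‖)
    (hint : ∀ v : ℝ → X, ContinuousOn v (Icc 0 T) →
      IntegrableOn (fun s => f s (v s)) (Icc 0 T)) (h : X) :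
    ∃ y : ℝ → X, ContinuousOn y (Icc 0 T) ∧
      ∀ t ∈ Icc 0 T, y t = h - ∫ s in t..T, f s (y s) := by
  -- Substituting `y s = e^{M(T-s)} z s` amounts to a weighted sup norm. In it the Volterra map has
  -- Lipschitz constant `K / M ≤ 1/2`, whatever the length of the interval; the `+ 1` keeps `M`
  -- positive when `K = 0`.
  set M : ℝ := 2 * K + 1 with hM
  have hMpos : 0 < M := by positivity
  let curve : C(Icc 0 T, X) → ℝ → X := fun z s => Real.exp (M * (T - s)) • IccExtend hT z s
  have hcurve : ∀ z, Continuous (curve z) := fun z =>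
    (by fun_prop : Continuous fun s : ℝ => Real.exp (M * (T - s))).smul z.continuous.Icc_extend'
  have hfi : ∀ z, IntegrableOn (fun s => f s (curve z s)) (uIcc 0 T) := fun z => by
    rw [uIcc_of_le hT]; exact hint _ (hcurve z).continuousOn
  have hfi' : ∀ z, ∀ t ∈ Icc 0 T, IntervalIntegrable (fun s => f s (curve z s)) volume t T := by
    intro z t ht
    refine (hfi z).intervalIntegrable.mono_set ?_
    rw [uIcc_of_le hT, uIcc_of_le ht.2]
    exact Icc_subset_Icc_left ht.1
  have hcont : ∀ z, Continuous fun t : Icc 0 T =>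
      Real.exp (-(M * (T - t))) • (h - ∫ s in (t : ℝ)..T, f s (curve z s)) := by
    intro z
    have h1 := intervalIntegral.continuousOn_primitive_interval_left (hfi z)
    rw [uIcc_of_le hT, continuousOn_iff_continuous_domRestrict] at h1
    exact (by fun_prop : Continuous fun t : Icc 0 T => Real.exp (-(M * (T - t)))).smul
      (continuous_const.sub h1)
  let Λ : C(Icc 0 T, X) → C(Icc 0 T, X) := fun z => ⟨_, hcont z⟩
  have hΛ : ContractingWith (1 / 2) Λ := by
    refine ⟨by rw [← NNReal.coe_lt_coe]; norm_num, LipschitzWith.of_dist_le_mul fun z w => ?_⟩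
    rw [dist_eq_norm, dist_eq_norm, ContinuousMap.norm_le _ (by positivity)]
    intro t
    have h1 : (Λ z - Λ w) t = Real.exp (-(M * (T - t))) •
        ∫ s in (t : ℝ)..T, (f s (curve w s) - f s (curve z s)) := by
      rw [intervalIntegral.integral_sub (hfi' w t t.2) (hfi' z t t.2)]
      simp only [Λ, ContinuousMap.sub_apply, ContinuousMap.coe_mk, ← smul_sub]
      congr 1; abel
    have h2 : ‖∫ s in (t : ℝ)..T, (f s (curve w s) - f s (curve z s))‖
        ≤ ∫ s in (t : ℝ)..T, K * (Real.exp (M * (T - s)) * ‖z - w‖) := by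
      refine intervalIntegral.norm_integral_le_of_norm_le t.2.2 (ae_of_all _ fun s hs => ?_)
        (Continuous.intervalIntegrable (by fun_prop) _ _)
      have hs' : s ∈ Icc 0 T := ⟨t.2.1.trans hs.1.le, hs.2⟩
      refine (hLip s hs' _ _).trans (mul_le_mul_of_nonneg_left ?_ hK)
      simp only [curve, ← smul_sub, norm_smul, Real.norm_eq_abs, Real.abs_exp]
      refine mul_le_mul_of_nonneg_left ?_ (Real.exp_pos _).le
      rw [norm_sub_rev, IccExtend_of_mem hT _ hs', IccExtend_of_mem hT _ hs']
      exact (z - w).norm_coe_le_norm _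
    have h3 : ∫ s in (t : ℝ)..T, K * (Real.exp (M * (T - s)) * ‖z - w‖)
        = K / M * (Real.exp (M * (T - t)) - 1) * ‖z - w‖ := by
      have hd : ∀ s ∈ uIcc (t : ℝ) T, HasDerivAt
          (fun s => -(K / M) * Real.exp (M * (T - s)) * ‖z - w‖)
          (K * (Real.exp (M * (T - s)) * ‖z - w‖)) s := by
        intro s _
        have h1 := ((((hasDerivAt_id' s).const_sub T).const_mul M).exp.const_mul
          (-(K / M))).mul_const ‖z - w‖
        refine h1.congr_deriv ?_
        field_simp
      rw [intervalIntegral.integral_eq_sub_of_hasDerivAt hd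
        (Continuous.intervalIntegrable (by fun_prop) _ _)]
      simp
      ring
    rw [h1, norm_smul, Real.norm_eq_abs, Real.abs_exp]
    have hKM : K / M ≤ 1 / 2 := by rw [div_le_iff₀ hMpos]; linarith
    calc Real.exp (-(M * (T - t))) * _
        ≤ Real.exp (-(M * (T - t))) * (K / M * (Real.exp (M * (T - t)) - 1) * ‖z - w‖) := by
          gcongr; exact h2.trans_eq h3
      _ = K / M * (1 - Real.exp (-(M * (T - t)))) * ‖z - w‖ := by
          rw [Real.exp_neg]; field_simp
      _ ≤ (1 / 2) * 1 * ‖z - w‖ := by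
          gcongr
          · rw [sub_nonneg, Real.exp_le_one_iff]
            nlinarith [t.2.2]
          · linarith [Real.exp_pos (-(M * (T - t)))]
      _ = _ := by push_cast; ring
  obtain ⟨z, hz, -⟩ := hΛ.exists_fixedPoint 0 (edist_ne_top _ _)
  refine ⟨curve z, (hcurve z).continuousOn, fun t ht => ?_⟩
  have h1 : IccExtend hT z t = Λ z ⟨t, ht⟩ := by
    rw [IccExtend_of_mem hT _ ht, hz.eq]
  change Real.exp (M * (T - t)) • IccExtend hT z t = _
  rw [h1]
  simp only [Λ, ContinuousMap.coe_mk, smul_smul, ← Real.exp_add]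
  simp

/-! ### Diagonal operators and the truncated backward heat group -/

section Diagonal

variable {H : Type*} [NormedAddCommGroup H] [InnerProductSpace ℝ H] (φ : HilbertBasis ℕ ℝ H)

theorem hasSum_smul_basis (v : H) : HasSum (fun j => ⟪v, φ j⟫ • φ j) v := by
  simpa only [φ.repr_apply_apply, real_inner_comm] using φ.hasSum_repr v

/-- Coefficients are continuous functionals, so a mild equation can be checked one mode at a time.
-/
theorem hasSum_smul_basis_iff {c : ℕ → ℝ} {v : H} :
    HasSum (fun j => c j • φ j) v ↔ ∀ j, ⟪v, φ j⟫ = c j := by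
  constructor
  · intro h j
    have h1 := h.mapL (innerSL ℝ (φ j))
    have h2 : HasSum (fun i => innerSL ℝ (φ j) (c i • φ i)) (c j) := by
      convert hasSum_single j ?_ using 1
      · simp [φ.orthonormal.1 j]
      · intro i hi
        simp [φ.orthonormal.2 hi.symm]
    rw [real_inner_comm]
    exact h1.unique h2
  · intro h
    simpa only [h] using hasSum_smul_basis φ v

theorem ext_coeff {v w : H} (h : ∀ j, ⟪v, φ j⟫ = ⟪w, φ j⟫) : v = w :=
  (hasSum_smul_basis φ v).unique ((hasSum_smul_basis_iff φ).2 fun j => (h j).symm)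

theorem hasSum_coeff_sq (v : H) : HasSum (fun j => ⟪v, φ j⟫ ^ 2) (‖v‖ ^ 2) := by
  have h := φ.hasSum_inner_mul_inner v v
  rw [real_inner_self_eq_norm_sq] at h
  refine h.congr_fun fun j => ?_
  rw [real_inner_comm v (φ j), sq]

theorem norm_le_of_abs_coeff_le {v w : H} {C : ℝ} (hC : 0 ≤ C)
    (h : ∀ j, |⟪v, φ j⟫| ≤ C * |⟪w, φ j⟫|) : ‖v‖ ≤ C * ‖w‖ := by
  refine (sq_le_sq₀ (norm_nonneg _) (by positivity)).1 ?_
  rw [mul_pow]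
  refine hasSum_le (fun j => ?_) (hasSum_coeff_sq φ v) ((hasSum_coeff_sq φ w).mul_left (C ^ 2))
  rw [← sq_abs, ← sq_abs ⟪w, φ j⟫, ← mul_pow]
  exact pow_le_pow_left₀ (abs_nonneg _) (h j) 2

theorem exists_coeff_eq_mul {a : ℕ → ℝ} {C : ℝ} (h : ∀ j, |a j| ≤ C) (v : H) :
    ∃ w : H, ∀ j, ⟪w, φ j⟫ = a j * ⟪v, φ j⟫ := by
  have hmem : Memℓp (fun j => a j * ⟪v, φ j⟫) 2 := by
    rw [memℓp_gen_iff (by simp)]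
    refine Summable.of_nonneg_of_le (fun j => by positivity) (fun j => ?_)
      ((hasSum_coeff_sq φ v).summable.mul_left (C ^ 2))
    simp only [ENNReal.toReal_ofNat, Real.rpow_ofNat, Real.norm_eq_abs, abs_mul, mul_pow, sq_abs]
    rw [← sq_abs (a j)]
    gcongr
    exact h j
  refine ⟨φ.repr.symm ⟨_, hmem⟩, fun j => ?_⟩
  rw [real_inner_comm, ← φ.repr_apply_apply, LinearIsometryEquiv.apply_symm_apply]

/-- The operator with eigenvectors `φ j` and (bounded) eigenvalues `a j`. -/
noncomputable def diagonal {a : ℕ → ℝ} {C : ℝ} (h : ∀ j, |a j| ≤ C) : H →L[ℝ] H :=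
  LinearMap.mkContinuous
    { toFun := fun v => (exists_coeff_eq_mul φ h v).choose
      map_add' := fun v w => ext_coeff φ fun j => by
        rw [(exists_coeff_eq_mul φ h (v + w)).choose_spec, inner_add_left, inner_add_left,
          (exists_coeff_eq_mul φ h v).choose_spec, (exists_coeff_eq_mul φ h w).choose_spec, mul_add]
      map_smul' := fun c v => ext_coeff φ fun j => by
        rw [(exists_coeff_eq_mul φ h (c • v)).choose_spec, RingHom.id_apply, real_inner_smul_left,
          real_inner_smul_left, (exists_coeff_eq_mul φ h v).choose_spec]
        ring } C fun v => by
    refine norm_le_of_abs_coeff_le φ ((abs_nonneg _).trans (h 0)) fun j => ?_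
    simp only [LinearMap.coe_mk, AddHom.coe_mk, (exists_coeff_eq_mul φ h v).choose_spec, abs_mul]
    exact mul_le_mul_of_nonneg_right (h j) (abs_nonneg _)

theorem inner_diagonal {a : ℕ → ℝ} {C : ℝ} (h : ∀ j, |a j| ≤ C) (v : H) (j : ℕ) :
    ⟪diagonal φ h v, φ j⟫ = a j * ⟪v, φ j⟫ :=
  (exists_coeff_eq_mul φ h v).choose_spec j

open Classical in
/-- The symbol `e^{tλ_j}` for `λ_j ≤ α`, `0` otherwise. -/
noncomputable def truncatedExp (lam : ℕ → ℝ) (α t : ℝ) (j : ℕ) : ℝ :=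
  if lam j ≤ α then Real.exp (t * lam j) else 0

variable {lam : ℕ → ℝ}

theorem abs_truncatedExp_le (hlam : ∀ j, 0 ≤ lam j) (α t : ℝ) (j : ℕ) :
    |truncatedExp lam α t j| ≤ Real.exp (|t| * |α|) := by
  unfold truncatedExp
  split_ifs with h
  · rw [Real.abs_exp, Real.exp_le_exp]
    calc t * lam j ≤ |t| * lam j := mul_le_mul_of_nonneg_right (le_abs_self t) (hlam j)
      _ ≤ |t| * |α| := mul_le_mul_of_nonneg_left (h.trans (le_abs_self α)) (abs_nonneg t)
  · simpa using (Real.exp_pos _).le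

/-- The truncated backward heat group `v ↦ ∑_{λ_j ≤ α} e^{tλ_j} ⟨v, φ_j⟩ φ_j`. -/
noncomputable def truncatedGroup (hlam : ∀ j, 0 ≤ lam j) (α t : ℝ) : H →L[ℝ] H :=
  diagonal φ (abs_truncatedExp_le hlam α t)

variable (hlam : ∀ j, 0 ≤ lam j) (α : ℝ)

theorem inner_truncatedGroup (t : ℝ) (v : H) (j : ℕ) :
    ⟪truncatedGroup φ hlam α t v, φ j⟫ = truncatedExp lam α t j * ⟪v, φ j⟫ :=
  inner_diagonal φ _ v j

theorem truncatedExp_add (s t : ℝ) (j : ℕ) :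
    truncatedExp lam α (s + t) j = truncatedExp lam α s j * truncatedExp lam α t j := by
  unfold truncatedExp
  split_ifs with h
  · rw [add_mul, Real.exp_add]
  · simp

/-- The sharp one-sided bound that produces the exponentials of the error estimate; the cruder
`e^{|t||α|}` covers both signs of `t` and serves continuity and existence. -/
theorem norm_truncatedGroup_apply_le {t : ℝ} (ht : 0 ≤ t) (v : H) :
    ‖truncatedGroup φ hlam α t v‖ ≤ Real.exp (t * α) * ‖v‖ := by
  refine norm_le_of_abs_coeff_le φ (Real.exp_pos _).le fun j => ?_
  rw [inner_truncatedGroup, abs_mul]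
  refine mul_le_mul_of_nonneg_right ?_ (abs_nonneg _)
  unfold truncatedExp
  split_ifs with h
  · rw [Real.abs_exp, Real.exp_le_exp]
    exact mul_le_mul_of_nonneg_left h ht
  · simpa using (Real.exp_pos _).le

theorem norm_truncatedGroup_le (t : ℝ) :
    ‖truncatedGroup φ hlam α t‖ ≤ Real.exp (|t| * |α|) :=
  ContinuousLinearMap.opNorm_le_bound _ (Real.exp_pos _).le fun v => by
    refine norm_le_of_abs_coeff_le φ (Real.exp_pos _).le fun j => ?_
    exact ((congrArg _ (inner_truncatedGroup φ hlam α t v j)).trans (abs_mul _ _)).trans_le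
      (mul_le_mul_of_nonneg_right (abs_truncatedExp_le hlam α t j) (abs_nonneg _))

theorem norm_truncatedGroup_sub_le (s t : ℝ) :
    ‖truncatedGroup φ hlam α t - truncatedGroup φ hlam α s‖ ≤
      Real.exp (|s| * |α|) * (Real.exp (|t - s| * |α|) - 1) := by
  have h0 : 0 ≤ Real.exp (|t - s| * |α|) - 1 :=
    sub_nonneg.2 (Real.one_le_exp (by positivity))
  refine ContinuousLinearMap.opNorm_le_bound _ (mul_nonneg (Real.exp_pos _).le h0) fun v => ?_
  refine norm_le_of_abs_coeff_le φ (mul_nonneg (Real.exp_pos _).le h0) fun j => ?_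
  rw [sub_apply, inner_sub_left, inner_truncatedGroup, inner_truncatedGroup, ← sub_mul, abs_mul]
  refine mul_le_mul_of_nonneg_right ?_ (abs_nonneg _)
  have h1 : truncatedExp lam α t j - truncatedExp lam α s j
      = truncatedExp lam α s j * (Real.exp ((t - s) * lam j) - 1) := by
    unfold truncatedExp
    split_ifs with h
    · rw [mul_sub, ← Real.exp_add]; ring_nf
    · simp
  by_cases hj : lam j ≤ α
  · rw [h1, abs_mul]
    refine mul_le_mul (abs_truncatedExp_le hlam α s j) ?_ (abs_nonneg _) (Real.exp_pos _).le
    have h2 : |(t - s) * lam j| ≤ |t - s| * |α| := by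
      rw [abs_mul, abs_of_nonneg (hlam j)]
      exact mul_le_mul_of_nonneg_left (hj.trans (le_abs_self α)) (abs_nonneg _)
    -- For `x ≤ 0` this is `2 ≤ e^x + e^{-x}`, that is `1 ≤ cosh x`.
    have h3 : ∀ x : ℝ, |Real.exp x - 1| ≤ Real.exp |x| - 1 := by
      intro x
      rcases le_total 0 x with hx | hx
      · rw [abs_of_nonneg hx, abs_of_nonneg (sub_nonneg.2 (Real.one_le_exp hx))]
      · rw [abs_of_nonpos hx, abs_of_nonpos (sub_nonpos.2 (Real.exp_le_one_iff.2 hx))]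
        linarith [Real.add_one_le_exp x, Real.add_one_le_exp (-x),
          Real.cosh_eq x, Real.one_le_cosh x]
    exact (h3 _).trans (sub_le_sub_right (Real.exp_le_exp.2 h2) 1)
  · simp only [truncatedExp, if_neg hj, sub_zero, abs_zero]
    exact mul_nonneg (Real.exp_pos _).le h0

theorem continuous_truncatedGroup : Continuous fun t => truncatedGroup φ hlam α t := by
  rw [continuous_iff_continuousAt]
  intro s
  rw [ContinuousAt, tendsto_iff_norm_sub_tendsto_zero]
  refine squeeze_zero (fun _ => norm_nonneg _) (norm_truncatedGroup_sub_le φ hlam α s) ?_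
  have : Continuous fun t : ℝ => Real.exp (|s| * |α|) * (Real.exp (|t - s| * |α|) - 1) := by
    fun_prop
  simpa using this.tendsto s

theorem truncation_eq_truncatedGroup (v : H) :
    truncation lam φ α v = truncatedGroup φ hlam α 0 v := by
  refine HasSum.tsum_eq ?_
  have h := (hasSum_smul_basis_iff φ).2 fun j => inner_truncatedGroup φ hlam α 0 v j
  refine h.congr_fun fun j => ?_
  unfold truncatedExp
  split_ifs <;> simp

end Diagonal

/-! ### The truncated problem with an abstract Lipschitz source -/

section Abstract

variable {H : Type*} [NormedAddCommGroup H] [InnerProductSpace ℝ H] (φ : HilbertBasis ℕ ℝ H)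
  {lam : ℕ → ℝ}

theorem truncatedExp_of_le {α t : ℝ} {j : ℕ} (h : lam j ≤ α) :
    truncatedExp lam α t j = Real.exp (t * lam j) := if_pos h

theorem truncatedExp_of_not_le {α t : ℝ} {j : ℕ} (h : ¬ lam j ≤ α) :
    truncatedExp lam α t j = 0 := if_neg h

theorem integrableOn_truncatedGroup_apply (hlam : ∀ j, 0 ≤ lam j) (α : ℝ)
    {T : ℝ} {f : ℝ → H} (hf : IntegrableOn f (Icc 0 T))
    {c : ℝ → ℝ} (hc : Continuous c) :
    IntegrableOn (fun s => truncatedGroup φ hlam α (c s) (f s)) (Icc 0 T) := by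
  have hE : Continuous fun s => truncatedGroup φ hlam α (c s) :=
    (continuous_truncatedGroup φ hlam α).comp hc
  obtain ⟨C, hC⟩ := isCompact_Icc.exists_bound_of_continuousOn (s := Icc 0 T) hE.continuousOn
  refine Integrable.mono' (hf.norm.const_mul C)
    ((ContinuousLinearMap.id ℝ (H →L[ℝ] H)).aestronglyMeasurable_comp₂
      hE.aestronglyMeasurable hf.1) ?_
  filter_upwards [ae_restrict_mem measurableSet_Icc] with s hs
  exact ContinuousLinearMap.le_of_opNorm_le _ (hC s hs) _

theorem intervalIntegrable_of_integrableOn_Icc {E : Type*} [NormedAddCommGroup E] {T t : ℝ}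
    {f : ℝ → E} (hf : IntegrableOn f (Icc 0 T)) (ht : t ∈ Icc 0 T) :
    IntervalIntegrable f volume t T := by
  rw [intervalIntegrable_iff_integrableOn_Icc_of_le ht.2]
  exact hf.mono_set (Icc_subset_Icc_left ht.1)

theorem inner_integral_truncatedGroup [CompleteSpace H] (hlam : ∀ j, 0 ≤ lam j) (α : ℝ)
    {T t : ℝ} {f : ℝ → H}
    (hf : IntegrableOn f (Icc 0 T)) (ht : t ∈ Icc 0 T) {c : ℝ → ℝ} (hc : Continuous c) (j : ℕ) :
    ⟪∫ s in t..T, truncatedGroup φ hlam α (c s) (f s), φ j⟫ =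
      ∫ s in t..T, truncatedExp lam α (c s) j * ⟪f s, φ j⟫ := by
  have h := (innerSL ℝ (φ j)).intervalIntegral_comp_comm (intervalIntegrable_of_integrableOn_Icc
    (integrableOn_truncatedGroup_apply φ hlam α hf hc) ht)
  rw [real_inner_comm, ← innerSL_apply_apply ℝ, ← h]
  simp only [innerSL_apply_apply, real_inner_comm _ (φ j), inner_truncatedGroup]

theorem mildCoeff_truncation (hlam : ∀ j, 0 ≤ lam j) (α : ℝ)
    (T : ℝ) (Q : ℝ → H → H) (G : H) (v : ℝ → H) (t : ℝ) (j : ℕ) :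
    mildCoeff T lam φ (fun s w => truncation lam φ α (Q s w)) (truncation lam φ α G) v t j =
      truncatedExp lam α 0 j * mildCoeff T lam φ Q G v t j := by
  simp only [mildCoeff, truncation_eq_truncatedGroup φ hlam, inner_truncatedGroup]
  by_cases h : lam j ≤ α
  · simp [truncatedExp_of_le h]
  · simp [truncatedExp_of_not_le h]

theorem isMildSolution_truncation_iff (hlam : ∀ j, 0 ≤ lam j) (α : ℝ)
    {T : ℝ} {Q : ℝ → H → H} {G : H} {v : ℝ → H} :
    IsMildSolution T lam φ (fun s w => truncation lam φ α (Q s w)) (truncation lam φ α G) v ↔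
      ContinuousOn v (Icc 0 T) ∧ ∀ t ∈ Icc 0 T, ∀ j,
        ⟪v t, φ j⟫ = truncatedExp lam α 0 j * mildCoeff T lam φ Q G v t j := by
  simp only [IsMildSolution, hasSum_smul_basis_iff φ, mildCoeff_truncation φ hlam]

theorem hasSum_subtype_of_isMildSolution_truncation (hlam : ∀ j, 0 ≤ lam j) (α : ℝ)
    {T : ℝ} {Q : ℝ → H → H} {G : H} {v : ℝ → H}
    (h : IsMildSolution T lam φ (fun s w => truncation lam φ α (Q s w)) (truncation lam φ α G) v)
    {t : ℝ} (ht : t ∈ Icc 0 T) :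
    HasSum (fun j : {j : ℕ // lam j ≤ α} => mildCoeff T lam φ Q G v t j • φ j) (v t) := by
  have h1 := (hasSum_smul_basis_iff φ).2 (((isMildSolution_truncation_iff φ hlam α).1 h).2 t ht)
  rw [← hasSum_subtype_iff_of_support_subset (s := {j | lam j ≤ α})] at h1
  · refine h1.congr_fun fun j => ?_
    have hj : lam j ≤ α := j.2
    simp [truncatedExp_of_le hj]
  · intro j hj
    by_contra hj'
    exact hj (by simp [truncatedExp_of_not_le (show ¬ lam j ≤ α from hj')])

/-- Pythagoras: `u - J_α u` lives on the modes above `α`, `J_α u - v` on those below. -/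
theorem norm_sq_eq_add_of_coeff_eq_zero (hlam : ∀ j, 0 ≤ lam j) (α : ℝ)
    {u v : H} (hv : ∀ j, ¬ lam j ≤ α → ⟪v, φ j⟫ = 0) :
    ‖u - v‖ ^ 2 = ‖u - truncatedGroup φ hlam α 0 u‖ ^ 2
      + ‖truncatedGroup φ hlam α 0 u - v‖ ^ 2 := by
  set p := truncatedGroup φ hlam α 0 u with hp
  have h0 : ⟪u - p, p - v⟫ = 0 := by
    refine (φ.hasSum_inner_mul_inner (u - p) (p - v)).unique ?_
    convert hasSum_zero with j
    rw [real_inner_comm (p - v) (φ j), inner_sub_left, inner_sub_left, hp, inner_truncatedGroup]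
    by_cases hj : lam j ≤ α
    · simp [truncatedExp_of_le hj]
    · simp [truncatedExp_of_not_le hj, hv j hj]
  have h1 := norm_add_sq_real (u - p) (p - v)
  rw [h0, sub_add_sub_cancel] at h1
  linarith

variable [CompleteSpace H]

/-- Writing `v t = E (-t) (y t)` frees the kernel of its dependence on `t`: the equation becomes `y
t = E T G - ∫_t^T E s (Q s (E (-s) (y s))) ds`, whose source is still Lipschitz because `E` is
bounded on `[-T, T]`. -/
theorem exists_isMildSolution_truncation (hlam : ∀ j, 0 ≤ lam j) (α : ℝ)
    {T k : ℝ} (hT : 0 ≤ T) (hk : 0 ≤ k) {Q : ℝ → H → H}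
    (hLip : ∀ s ∈ Icc 0 T, ∀ w w', ‖Q s w - Q s w'‖ ≤ k * ‖w - w'‖)
    (hint : ∀ v : ℝ → H, ContinuousOn v (Icc 0 T) → IntegrableOn (fun s => Q s (v s)) (Icc 0 T))
    (G : H) :
    ∃ v, IsMildSolution T lam φ (fun s w => truncation lam φ α (Q s w))
      (truncation lam φ α G) v := by
  set E := truncatedGroup φ hlam α with hE
  have hEc : Continuous E := continuous_truncatedGroup φ hlam α
  have hEb : ∀ s : ℝ, |s| ≤ T → ‖E s‖ ≤ Real.exp (T * |α|) := fun s hs =>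
    (norm_truncatedGroup_le φ hlam α s).trans
      (Real.exp_le_exp.2 (mul_le_mul_of_nonneg_right hs (abs_nonneg α)))
  have hcurve : ∀ y : ℝ → H, ContinuousOn y (Icc 0 T) →
      ContinuousOn (fun s => E (-s) (y s)) (Icc 0 T) := fun y hy =>
    (hEc.comp continuous_neg).continuousOn.clm_apply hy
  obtain ⟨y, hyc, hy⟩ := exists_solution_volterra (X := H)
    (K := Real.exp (T * |α|) * (k * Real.exp (T * |α|))) hT (by positivity)
    (fun s w => E s (Q s (E (-s) w))) (fun s hs w w' => by
      have habs : |s| ≤ T := by rw [abs_of_nonneg hs.1]; exact hs.2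
      rw [← map_sub]
      refine (ContinuousLinearMap.le_of_opNorm_le _ (hEb s habs) _).trans ?_
      rw [mul_assoc]
      refine mul_le_mul_of_nonneg_left ((hLip s hs _ _).trans ?_) (Real.exp_pos _).le
      rw [← map_sub, mul_assoc]
      exact mul_le_mul_of_nonneg_left
        (ContinuousLinearMap.le_of_opNorm_le _ (hEb (-s) (by rwa [abs_neg])) _) hk)
    (fun y hy => integrableOn_truncatedGroup_apply φ hlam α (hint _ (hcurve y hy)) continuous_id)
    (E T G)
  refine ⟨fun t => E (-t) (y t), (isMildSolution_truncation_iff φ hlam α).2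
    ⟨hcurve y hyc, fun t ht j => ?_⟩⟩
  have h1 := inner_integral_truncatedGroup φ hlam α (hint _ (hcurve y hyc)) ht continuous_id j
  simp only [hy t ht, hE, inner_truncatedGroup, inner_sub_left, map_sub] at h1 ⊢
  simp only [id] at h1
  rw [h1, mildCoeff]
  by_cases hj : lam j ≤ α
  · simp only [truncatedExp_of_le hj, zero_mul, Real.exp_zero, one_mul, sub_eq_add_neg T t,
      sub_eq_add_neg _ t, add_mul, Real.exp_add, mul_right_comm _ (Real.exp (-t * lam j))]
    rw [intervalIntegral.integral_mul_const]
    ring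
  · simp [truncatedExp_of_not_le hj]

/-- Stability of the truncated backward problem: comparison of a curve `u` whose low frequencies
satisfy the mild equation with a truncated solution `v`. -/
theorem exp_mul_norm_sub_sq_le (hlam : ∀ j, 0 ≤ lam j) (α : ℝ)
    {T k B : ℝ} {Q : ℝ → H → H}
    (hLip : ∀ s ∈ Icc 0 T, ∀ w w', ‖Q s w - Q s w'‖ ≤ k * ‖w - w'‖)
    (hint : ∀ v : ℝ → H, ContinuousOn v (Icc 0 T) → IntegrableOn (fun s => Q s (v s)) (Icc 0 T))
    {g G : H} {u v : ℝ → H} (huc : ContinuousOn u (Icc 0 T))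
    (hu : ∀ t ∈ Icc 0 T, ∀ j, lam j ≤ α → ⟪u t, φ j⟫ = mildCoeff T lam φ Q g u t j)
    (hv : IsMildSolution T lam φ (fun s w => truncation lam φ α (Q s w)) (truncation lam φ α G) v)
    (hB : ∀ t ∈ Icc 0 T,
      Real.exp (2 * t * α) * ‖u t - truncatedGroup φ hlam α 0 (u t)‖ ^ 2 ≤ B)
    {t : ℝ} (ht : t ∈ Icc 0 T) :
    Real.exp (2 * t * α) * ‖u t - v t‖ ^ 2 ≤
      (B + 2 * Real.exp (2 * T * α) * ‖g - G‖ ^ 2) * Real.exp (2 * k ^ 2 * T * (T - t)) := by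
  have hT : 0 ≤ T := ht.1.trans ht.2
  obtain ⟨hvc, hv⟩ := (isMildSolution_truncation_iff φ hlam α).1 hv
  have hexp : ∀ r, Real.exp (2 * r * α) = Real.exp (r * α) ^ 2 := fun r => by
    rw [← Real.exp_nat_mul]; push_cast; ring_nf
  have hdc : ContinuousOn (fun s => Real.exp (s * α) * ‖u s - v s‖) (Icc 0 T) :=
    (by fun_prop : Continuous fun s : ℝ => Real.exp (s * α)).continuousOn.mul (huc.sub hvc).norm
  refine le_mul_exp_of_le_add_integral (y := fun s => Real.exp (2 * s * α) * ‖u s - v s‖ ^ 2)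
    (by positivity) ?_ ?_ ht
  · simp only [hexp, ← mul_pow]
    exact hdc.pow 2
  clear ht t
  intro t ht
  have hdc' : ContinuousOn (fun s => Real.exp (s * α) * ‖u s - v s‖) (Icc t T) :=
    hdc.mono (Icc_subset_Icc_left ht.1)
  set p := truncatedGroup φ hlam α 0 (u t) with hp
  -- Difference of the two mild equations on the modes below `α`; the modes above vanish on both
  -- sides.
  have hid : p - v t = truncatedGroup φ hlam α (T - t) (g - G)
      - ∫ s in t..T, truncatedGroup φ hlam α (s - t) (Q s (u s) - Q s (v s)) := by
    refine ext_coeff φ fun j => ?_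
    rw [inner_sub_left, inner_sub_left, hp, inner_truncatedGroup, inner_truncatedGroup,
      inner_integral_truncatedGroup φ hlam α (f := fun s => Q s (u s) - Q s (v s))
        ((hint u huc).sub (hint v hvc)) ht (c := fun s => s - t) (by fun_prop), hv t ht j]
    by_cases hj : lam j ≤ α
    · have hi : ∀ w : ℝ → H, ContinuousOn w (Icc 0 T) → IntervalIntegrable
          (fun s => Real.exp ((s - t) * lam j) * ⟪Q s (w s), φ j⟫) volume t T := by
        intro w hw
        refine IntervalIntegrable.continuousOn_mul ?_ (by fun_prop)
        have := (innerSL ℝ (φ j)).integrable_comp (hint w hw)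
        simp only [innerSL_apply_apply, real_inner_comm _ (φ j)] at this
        exact intervalIntegrable_of_integrableOn_Icc this ht
      rw [hu t ht j hj]
      simp only [mildCoeff, truncatedExp_of_le hj, zero_mul, Real.exp_zero, one_mul,
        inner_sub_left, mul_sub]
      rw [intervalIntegral.integral_sub (hi u huc) (hi v hvc)]
      ring
    · simp [truncatedExp_of_not_le hj]
  -- Multiplying by `e^{tα}` turns the kernel bound `e^{(s-t)α}` into the weight `e^{sα}` of the
  -- unknown.
  have hnorm : Real.exp (t * α) * ‖p - v t‖ ≤ Real.exp (T * α) * ‖g - G‖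
      + k * ∫ s in t..T, Real.exp (s * α) * ‖u s - v s‖ := by
    have h1 := norm_truncatedGroup_apply_le φ hlam α (sub_nonneg.2 ht.2) (g - G)
    have h2 : ‖∫ s in t..T, truncatedGroup φ hlam α (s - t) (Q s (u s) - Q s (v s))‖
        ≤ ∫ s in t..T, Real.exp (-(t * α)) * k * (Real.exp (s * α) * ‖u s - v s‖) := by
      refine intervalIntegral.norm_integral_le_of_norm_le ht.2 (ae_of_all _ fun s hs => ?_)
        ((hdc'.intervalIntegrable_of_Icc ht.2).const_mul _)
      refine (norm_truncatedGroup_apply_le φ hlam α (sub_nonneg.2 hs.1.le) _).trans ?_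
      calc Real.exp ((s - t) * α) * ‖Q s (u s) - Q s (v s)‖
          ≤ Real.exp ((s - t) * α) * (k * ‖u s - v s‖) :=
            mul_le_mul_of_nonneg_left (hLip s ⟨ht.1.trans hs.1.le, hs.2⟩ _ _) (Real.exp_pos _).le
        _ = _ := by
            rw [sub_mul, sub_eq_add_neg, Real.exp_add]; ring
    rw [intervalIntegral.integral_const_mul] at h2
    have h3 := (norm_sub_le (truncatedGroup φ hlam α (T - t) (g - G))
      (∫ s in t..T, truncatedGroup φ hlam α (s - t) (Q s (u s) - Q s (v s)))).trans
      (add_le_add h1 h2)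
    rw [← hid] at h3
    refine (mul_le_mul_of_nonneg_left h3 (Real.exp_pos (t * α)).le).trans_eq ?_
    rw [mul_add, ← mul_assoc, ← mul_assoc, ← mul_assoc, ← Real.exp_add, ← Real.exp_add,
      add_neg_cancel, Real.exp_zero, one_mul, sub_mul, add_sub_cancel]
  have hcs := sq_intervalIntegral_le ht.2 hdc'
  set I := ∫ s in t..T, Real.exp (s * α) * ‖u s - v s‖
  have hJ : 0 ≤ ∫ s in t..T, (Real.exp (s * α) * ‖u s - v s‖) ^ 2 :=
    intervalIntegral.integral_nonneg ht.2 fun s _ => sq_nonneg _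
  have hJeq : ∫ s in t..T, Real.exp (2 * s * α) * ‖u s - v s‖ ^ 2
      = ∫ s in t..T, (Real.exp (s * α) * ‖u s - v s‖) ^ 2 := by
    simp only [hexp, ← mul_pow]
  rw [hJeq]
  set J := ∫ s in t..T, (Real.exp (s * α) * ‖u s - v s‖) ^ 2
  have hpyth := norm_sq_eq_add_of_coeff_eq_zero φ hlam α (u := u t) (v := v t)
    fun j hj => by rw [hv t ht j, truncatedExp_of_not_le hj, zero_mul]
  have hsq : (Real.exp (t * α) * ‖p - v t‖) ^ 2 ≤ 2 * (Real.exp (T * α) * ‖g - G‖) ^ 2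
      + 2 * (k * I) ^ 2 := by
    refine (pow_le_pow_left₀ (by positivity) hnorm 2).trans ?_
    linarith [add_sq_le (a := Real.exp (T * α) * ‖g - G‖) (b := k * I)]
  -- Cauchy-Schwarz on `[t, T]` with `T - t ≤ T`; with the 2 from squaring the sum, the Grönwall
  -- rate is `2k²T`.
  have hI : (k * I) ^ 2 ≤ k ^ 2 * T * J := by
    rw [mul_pow, mul_assoc]
    refine mul_le_mul_of_nonneg_left (hcs.trans ?_) (sq_nonneg k)
    exact mul_le_mul_of_nonneg_right (by linarith [ht.1]) hJ
  have hBt := hB t ht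
  rw [hpyth, mul_add, hexp T]
  rw [mul_pow, ← hexp] at hsq
  rw [mul_pow] at hsq
  linarith

end Abstract

/-! ### Measurability, Lipschitz bound and integrability of the superposition -/

/-- A Hilbert-space valued function with measurable coefficients is strongly measurable. -/
theorem stronglyMeasurable_of_coeff {H S : Type*} [NormedAddCommGroup H] [InnerProductSpace ℝ H]
    [MeasurableSpace S] (φ : HilbertBasis ℕ ℝ H) {f : S → H}
    (h : ∀ j, StronglyMeasurable fun s => ⟪f s, φ j⟫) : StronglyMeasurable f := by
  refine stronglyMeasurable_of_tendsto (u := atTop)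
    (f := fun n s => ∑ j ∈ Finset.range n, ⟪f s, φ j⟫ • φ j) (fun n => ?_) ?_
  · exact Finset.stronglyMeasurable_fun_sum _ fun j _ => (h j).smul_const _
  · exact tendsto_pi_nhds.2 fun s => (hasSum_smul_basis φ (f s)).tendsto_sum_nat

section Superposition

variable {d : ℕ} {Ω : Set (EuclideanSpace ℝ (Fin d))}

open Classical in
/-- `F` set to zero outside `Ω × [0,T]`. -/
noncomputable def cutoff (Ω : Set (EuclideanSpace ℝ (Fin d))) (T : ℝ)
    (F : EuclideanSpace ℝ (Fin d) → ℝ → ℝ → ℝ) (x : EuclideanSpace ℝ (Fin d)) (s z : ℝ) : ℝ :=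
  if x ∈ Ω ∧ s ∈ Icc 0 T then F x s z else 0

variable {T k : ℝ} {F : EuclideanSpace ℝ (Fin d) → ℝ → ℝ → ℝ}

theorem abs_cutoff_sub_le (hk : 0 ≤ k)
    (hFLip : ∀ x ∈ Ω, ∀ t ∈ Icc 0 T, ∀ z z' : ℝ, |F x t z - F x t z'| ≤ k * |z - z'|)
    (x : EuclideanSpace ℝ (Fin d)) (s z z' : ℝ) :
    |cutoff Ω T F x s z - cutoff Ω T F x s z'| ≤ k * |z - z'| := by
  unfold cutoff
  split_ifs with h
  · exact hFLip x h.1 s h.2 z z'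
  · simpa using mul_nonneg hk (abs_nonneg _)

/-- Allows `F` to be replaced by its cutoff, which is Lipschitz in `z` at every `(x, s)`, as the
Carathéodory argument for joint measurability requires. -/
theorem superposition_cutoff (hΩ : MeasurableSet Ω) {s : ℝ} (hs : s ∈ Icc 0 T) (w : L2 Ω) :
    superposition Ω (cutoff Ω T F) s w = superposition Ω F s w := by
  have h : (fun x => cutoff Ω T F x s (w x)) =ᵐ[volume.restrict Ω] fun x => F x s (w x) := by
    filter_upwards [ae_restrict_mem hΩ] with x hx
    exact if_pos ⟨hx, hs⟩
  unfold superposition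
  by_cases h1 : MemLp (fun x => F x s (w x)) 2 (volume.restrict Ω)
  · rw [dif_pos h1, dif_pos ((memLp_congr_ae h).2 h1)]
    exact (MemLp.toLp_eq_toLp_iff _ _).2 h
  · rw [dif_neg h1, dif_neg (mt (memLp_congr_ae h).1 h1)]

theorem stronglyMeasurable_cutoff_comp (hΩ : MeasurableSet Ω) (hk : 0 ≤ k)
    (hFmeas : ∀ z : ℝ, Measurable fun p : EuclideanSpace ℝ (Fin d) × ℝ => F p.1 p.2 z)
    (hFLip : ∀ x ∈ Ω, ∀ t ∈ Icc 0 T, ∀ z z' : ℝ, |F x t z - F x t z'| ≤ k * |z - z'|)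
    {w : EuclideanSpace ℝ (Fin d) → ℝ} (hw : Measurable w) :
    StronglyMeasurable fun p : EuclideanSpace ℝ (Fin d) × ℝ =>
      cutoff Ω T F p.1 p.2 (w p.1) := by
  have h1 : StronglyMeasurable (Function.uncurry fun (z : ℝ)
      (p : EuclideanSpace ℝ (Fin d) × ℝ) => cutoff Ω T F p.1 p.2 z) := by
    refine stronglyMeasurable_uncurry_of_continuous_of_stronglyMeasurable (fun p => ?_) fun z => ?_
    · refine (LipschitzWith.of_dist_le_mul (K := ⟨k, hk⟩) fun z z' => ?_).continuous
      rw [Real.dist_eq, Real.dist_eq]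
      exact abs_cutoff_sub_le hk hFLip p.1 p.2 z z'
    · refine Measurable.stronglyMeasurable (Measurable.ite ?_ (hFmeas z) measurable_const)
      exact (hΩ.preimage measurable_fst).inter (measurableSet_Icc.preimage measurable_snd)
  exact h1.comp_measurable (g := fun p => (w p.1, p)) (by fun_prop)

/-- The difference is dominated by `k |w' - w|`. Hence the exceptional times, where `superposition`
defaults to `0`, do not depend on `w`, and the Lipschitz bound survives the default. -/
theorem memLp_cutoff_comp_of_memLp (hΩ : MeasurableSet Ω) (hk : 0 ≤ k)
    (hFmeas : ∀ z : ℝ, Measurable fun p : EuclideanSpace ℝ (Fin d) × ℝ => F p.1 p.2 z)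
    (hFLip : ∀ x ∈ Ω, ∀ t ∈ Icc 0 T, ∀ z z' : ℝ, |F x t z - F x t z'| ≤ k * |z - z'|)
    (s : ℝ) (w w' : L2 Ω) :
    MemLp (fun x => cutoff Ω T F x s (w x)) 2 (volume.restrict Ω) →
      MemLp (fun x => cutoff Ω T F x s (w' x)) 2 (volume.restrict Ω) := by
  intro h
  have hm : ∀ w : L2 Ω, StronglyMeasurable fun x => cutoff Ω T F x s (w x) := fun w =>
    (stronglyMeasurable_cutoff_comp hΩ hk hFmeas hFLip
      (Lp.stronglyMeasurable w).measurable).comp_measurable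
      (g := fun x => (x, s)) (by fun_prop)
  have hd : MemLp (fun x => cutoff Ω T F x s (w' x) - cutoff Ω T F x s (w x)) 2
      (volume.restrict Ω) := by
    refine MemLp.of_le_mul (c := k) ((Lp.memLp w').sub (Lp.memLp w))
      ((hm w').sub (hm w)).aestronglyMeasurable (ae_of_all _ fun x => ?_)
    exact abs_cutoff_sub_le hk hFLip x s _ _
  exact (h.add hd).ae_eq (ae_of_all _ fun x => add_sub_cancel _ _)

theorem norm_superposition_cutoff_sub_le (hΩ : MeasurableSet Ω) (hk : 0 ≤ k)
    (hFmeas : ∀ z : ℝ, Measurable fun p : EuclideanSpace ℝ (Fin d) × ℝ => F p.1 p.2 z)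
    (hFLip : ∀ x ∈ Ω, ∀ t ∈ Icc 0 T, ∀ z z' : ℝ, |F x t z - F x t z'| ≤ k * |z - z'|)
    (s : ℝ) (w w' : L2 Ω) :
    ‖superposition Ω (cutoff Ω T F) s w - superposition Ω (cutoff Ω T F) s w'‖
      ≤ k * ‖w - w'‖ := by
  unfold superposition
  by_cases h : MemLp (fun x => cutoff Ω T F x s (w x)) 2 (volume.restrict Ω)
  · have h' := memLp_cutoff_comp_of_memLp hΩ hk hFmeas hFLip s w w' h
    rw [dif_pos h, dif_pos h', ← MemLp.toLp_sub]
    refine Lp.norm_le_mul_norm_of_ae_le_mul ?_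
    filter_upwards [MemLp.coeFn_toLp (h.sub h'), Lp.coeFn_sub w w'] with x h1 h2
    rw [h1, h2]
    exact abs_cutoff_sub_le hk hFLip x s _ _
  · rw [dif_neg h, dif_neg (mt (memLp_cutoff_comp_of_memLp hΩ hk hFmeas hFLip s w' w) h)]
    simpa using mul_nonneg hk (norm_nonneg _)

theorem norm_superposition_sub_le (hΩ : MeasurableSet Ω) (hk : 0 ≤ k)
    (hFmeas : ∀ z : ℝ, Measurable fun p : EuclideanSpace ℝ (Fin d) × ℝ => F p.1 p.2 z)
    (hFLip : ∀ x ∈ Ω, ∀ t ∈ Icc 0 T, ∀ z z' : ℝ, |F x t z - F x t z'| ≤ k * |z - z'|)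
    (s : ℝ) (hs : s ∈ Icc 0 T) (w w' : L2 Ω) :
    ‖superposition Ω F s w - superposition Ω F s w'‖ ≤ k * ‖w - w'‖ := by
  rw [← superposition_cutoff hΩ hs w, ← superposition_cutoff hΩ hs w']
  exact norm_superposition_cutoff_sub_le hΩ hk hFmeas hFLip s w w'

theorem memLp_two_iff_lintegral {S : Type*} [MeasurableSpace S] {μ : Measure S} {f : S → ℝ}
    (hf : AEStronglyMeasurable f μ) : MemLp f 2 μ ↔ ∫⁻ x, ‖f x‖ₑ ^ 2 ∂μ < ∞ := by
  rw [MemLp, and_iff_right hf, eLpNorm_lt_top_iff_lintegral_rpow_enorm_lt_top (by simp) (by simp)]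
  simp

theorem stronglyMeasurable_superposition_cutoff (φ : HilbertBasis ℕ ℝ (L2 Ω))
    (hΩ : MeasurableSet Ω) (hk : 0 ≤ k)
    (hFmeas : ∀ z : ℝ, Measurable fun p : EuclideanSpace ℝ (Fin d) × ℝ => F p.1 p.2 z)
    (hFLip : ∀ x ∈ Ω, ∀ t ∈ Icc 0 T, ∀ z z' : ℝ, |F x t z - F x t z'| ≤ k * |z - z'|)
    (w : L2 Ω) : StronglyMeasurable fun s => superposition Ω (cutoff Ω T F) s w := by
  have hm := stronglyMeasurable_cutoff_comp hΩ hk hFmeas hFLip (Lp.stronglyMeasurable w).measurable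
  have hms : ∀ s, StronglyMeasurable fun x => cutoff Ω T F x s (w x) := fun s =>
    hm.comp_measurable (g := fun x => (x, s)) (by fun_prop)
  refine stronglyMeasurable_of_coeff φ fun j => ?_
  -- By Tonelli the squared norm is measurable in `s`; on this set each coefficient is a parameter
  -- integral, off it zero.
  have hset : MeasurableSet {s | MemLp (fun x => cutoff Ω T F x s (w x)) 2 (volume.restrict Ω)} := by
    simp only [memLp_two_iff_lintegral (hms _).aestronglyMeasurable]
    refine measurableSet_lt ?_ measurable_const
    exact Measurable.lintegral_prod_left' (f := fun p : EuclideanSpace ℝ (Fin d) × ℝ =>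
      ‖cutoff Ω T F p.1 p.2 (w p.1)‖ₑ ^ 2) (hm.measurable.enorm.pow_const 2)
  have hI : StronglyMeasurable fun s => ∫ x in Ω, cutoff Ω T F x s (w x) * φ j x := by
    refine StronglyMeasurable.integral_prod_left
      (f := fun x s => cutoff Ω T F x s (w x) * φ j x) ?_
    exact hm.mul ((Lp.stronglyMeasurable (φ j)).comp_measurable measurable_fst)
  convert StronglyMeasurable.indicator hI hset with s
  by_cases h : MemLp (fun x => cutoff Ω T F x s (w x)) 2 (volume.restrict Ω)
  · rw [indicator_of_mem (by exact h), superposition, dif_pos h, L2.inner_def]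
    refine integral_congr_ae ?_
    filter_upwards [h.coeFn_toLp] with x hx
    rw [hx]
    simp [mul_comm]
  · rw [indicator_of_notMem (by exact h), superposition, dif_neg h, inner_zero_left]

theorem integrableOn_superposition_cutoff_zero (φ : HilbertBasis ℕ ℝ (L2 Ω))
    (hΩ : MeasurableSet Ω) (hk : 0 ≤ k)
    (hFmeas : ∀ z : ℝ, Measurable fun p : EuclideanSpace ℝ (Fin d) × ℝ => F p.1 p.2 z)
    (hFLip : ∀ x ∈ Ω, ∀ t ∈ Icc 0 T, ∀ z z' : ℝ, |F x t z - F x t z'| ≤ k * |z - z'|)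
    (hF0 : MemLp (fun p : EuclideanSpace ℝ (Fin d) × ℝ => F p.1 p.2 0) 2
      ((volume.restrict Ω).prod (volume.restrict (Icc 0 T)))) :
    IntegrableOn (fun s => superposition Ω (cutoff Ω T F) s 0) (Icc 0 T) := by
  have hsq := hF0.integrable_sq
  have h1 := hsq.integral_norm_prod_right
  have hconst : Integrable (fun _ : ℝ => (1 : ℝ)) (volume.restrict (Icc 0 T)) :=
    integrable_const _
  refine Integrable.mono' (hconst.add h1) (stronglyMeasurable_superposition_cutoff φ hΩ hk hFmeas
    hFLip 0).aestronglyMeasurable ?_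
  filter_upwards [ae_restrict_mem measurableSet_Icc] with s hs
  have hz : 0 ≤ ∫ x in Ω, ‖F x s 0 ^ 2‖ := integral_nonneg fun x => norm_nonneg _
  have hle : ‖superposition Ω (cutoff Ω T F) s 0‖ ^ 2 ≤ ∫ x in Ω, ‖F x s 0 ^ 2‖ := by
    rw [superposition_cutoff hΩ hs, superposition]
    split_ifs with h
    · rw [← real_inner_self_eq_norm_sq, L2.inner_def]
      refine (integral_congr_ae ?_).le
      filter_upwards [h.coeFn_toLp, Lp.coeFn_zero ℝ 2 (volume.restrict Ω)] with x hx h0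
      rw [hx, h0]
      simp [sq]
    · simpa using hz
  simp only [Pi.add_apply]
  -- The dominating function comes from `x ≤ 1 + x²`.
  nlinarith [sq_nonneg (‖superposition Ω (cutoff Ω T F) s 0‖ - 1)]

theorem integrableOn_superposition (φ : HilbertBasis ℕ ℝ (L2 Ω)) (hΩ : MeasurableSet Ω)
    (hT : 0 ≤ T) (hk : 0 ≤ k)
    (hFmeas : ∀ z : ℝ, Measurable fun p : EuclideanSpace ℝ (Fin d) × ℝ => F p.1 p.2 z)
    (hFLip : ∀ x ∈ Ω, ∀ t ∈ Icc 0 T, ∀ z z' : ℝ, |F x t z - F x t z'| ≤ k * |z - z'|)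
    (hF0 : MemLp (fun p : EuclideanSpace ℝ (Fin d) × ℝ => F p.1 p.2 0) 2
      ((volume.restrict Ω).prod (volume.restrict (Icc 0 T))))
    (v : ℝ → L2 Ω) (hv : ContinuousOn v (Icc 0 T)) :
    IntegrableOn (fun s => superposition Ω F s (v s)) (Icc 0 T) := by
  set V : ℝ → L2 Ω := IccExtend hT (fun s => v s) with hV
  have hVc : Continuous V := (continuousOn_iff_continuous_domRestrict.1 hv).Icc_extend'
  have hLip := norm_superposition_cutoff_sub_le hΩ hk hFmeas hFLip
  have hmeas : StronglyMeasurable fun s => superposition Ω (cutoff Ω T F) s (V s) := by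
    -- Separating the time in the curve from the time in `F` gives a map continuous in `r` and
    -- measurable in `s`; it is then restricted to the diagonal.
    have h1 : StronglyMeasurable (Function.uncurry fun r s =>
        superposition Ω (cutoff Ω T F) s (V r)) := by
      refine stronglyMeasurable_uncurry_of_continuous_of_stronglyMeasurable (fun s => ?_)
        fun r => stronglyMeasurable_superposition_cutoff φ hΩ hk hFmeas hFLip (V r)
      have h2 : LipschitzWith ⟨k, hk⟩ (superposition Ω (cutoff Ω T F) s) :=
        LipschitzWith.of_dist_le_mul fun w w' => by
          rw [dist_eq_norm, dist_eq_norm]; exact hLip s w w'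
      exact h2.continuous.comp hVc
    exact h1.comp_measurable (g := fun s => (s, s)) (by fun_prop)
  have hint : IntegrableOn (fun s => superposition Ω (cutoff Ω T F) s (V s)) (Icc 0 T) := by
    refine Integrable.mono' ((integrableOn_superposition_cutoff_zero φ hΩ hk hFmeas hFLip hF0).norm.add
      ((hVc.norm.continuousOn.integrableOn_Icc (a := 0) (b := T)).const_mul k))
      hmeas.aestronglyMeasurable (ae_of_all _ fun s => ?_)
    have h1 := hLip s (V s) 0
    rw [sub_zero] at h1
    simp only [Pi.add_apply]
    linarith [norm_le_norm_add_norm_sub (superposition Ω (cutoff Ω T F) s 0)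
      (superposition Ω (cutoff Ω T F) s (V s)), norm_sub_rev (superposition Ω (cutoff Ω T F) s 0)
      (superposition Ω (cutoff Ω T F) s (V s))]
  refine hint.congr_fun (fun s hs => ?_) measurableSet_Icc
  simp only [superposition_cutoff hΩ hs, hV, IccExtend_of_mem hT _ hs]

end Superposition

/-! ### Poincaré inequality and positivity of the Dirichlet eigenvalues -/

section Poincare

variable {d : ℕ} {Ω : Set (EuclideanSpace ℝ (Fin d))}

theorem norm_gradient_eq {f : EuclideanSpace ℝ (Fin d) → ℝ} (x : EuclideanSpace ℝ (Fin d)) :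
    ‖gradient f x‖ = ‖fderiv ℝ f x‖ :=
  (InnerProductSpace.toDual ℝ (EuclideanSpace ℝ (Fin d))).symm.norm_map _

theorem IsTestFunction.continuous_gradient {f : EuclideanSpace ℝ (Fin d) → ℝ}
    (hf : IsTestFunction Ω f) : Continuous (gradient f) :=
  (InnerProductSpace.toDual ℝ (EuclideanSpace ℝ (Fin d))).symm.continuous.comp
    (hf.1.continuous_fderiv (by simp))

theorem IsTestFunction.hasCompactSupport_gradient {f : EuclideanSpace ℝ (Fin d) → ℝ}
    (hf : IsTestFunction Ω f) : HasCompactSupport (gradient f) :=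
  (hf.2.1.fderiv ℝ).comp_left (map_zero _)

theorem IsTestFunction.memLp {f : EuclideanSpace ℝ (Fin d) → ℝ} (hf : IsTestFunction Ω f) :
    MemLp f 2 (volume.restrict Ω) :=
  (hf.1.continuous.memLp_of_hasCompactSupport hf.2.1).restrict Ω

theorem IsTestFunction.memLp_gradient {f : EuclideanSpace ℝ (Fin d) → ℝ}
    (hf : IsTestFunction Ω f) : MemLp (gradient f) 2 (volume.restrict Ω) :=
  (hf.continuous_gradient.memLp_of_hasCompactSupport hf.hasCompactSupport_gradient).restrict Ω

theorem hasCompactSupport_sq {f : EuclideanSpace ℝ (Fin d) → ℝ} (hf : HasCompactSupport f) :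
    HasCompactSupport fun x => f x ^ 2 :=
  hf.comp_left (g := fun z : ℝ => z ^ 2) (by simp)

theorem IsTestFunction.integrable_sq {f : EuclideanSpace ℝ (Fin d) → ℝ}
    (hf : IsTestFunction Ω f) : Integrable fun x => f x ^ 2 :=
  (hf.1.continuous.pow 2).integrable_of_hasCompactSupport (hasCompactSupport_sq hf.2.1)

theorem IsTestFunction.integrable_norm_gradient_sq {f : EuclideanSpace ℝ (Fin d) → ℝ}
    (hf : IsTestFunction Ω f) : Integrable fun x => ‖gradient f x‖ ^ 2 :=
  (hf.continuous_gradient.norm.pow 2).integrable_of_hasCompactSupport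
    (hasCompactSupport_sq hf.hasCompactSupport_gradient.norm)

theorem IsTestFunction.integrable_mul_fderiv {f : EuclideanSpace ℝ (Fin d) → ℝ}
    (hf : IsTestFunction Ω f) {p : EuclideanSpace ℝ (Fin d) → ℝ} (hp : Continuous p)
    (e : EuclideanSpace ℝ (Fin d)) : Integrable fun x => p x * (2 * f x * fderiv ℝ f x e) := by
  have hdf : Continuous fun x => fderiv ℝ f x e :=
    (hf.1.continuous_fderiv (by simp)).clm_apply continuous_const
  have hc : Continuous fun x => f x * (p x * 2 * fderiv ℝ f x e) :=
    hf.1.continuous.mul ((hp.mul continuous_const).mul hdf)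
  have h := hc.integrable_of_hasCompactSupport (μ := volume) hf.2.1.mul_right
  exact h.congr (ae_of_all _ fun x => by ring)

/-- Integration by parts of `p · ∂_e (f²)`, with `∂_e p = 1`. -/
theorem IsTestFunction.integral_mul_fderiv {f : EuclideanSpace ℝ (Fin d) → ℝ}
    (hf : IsTestFunction Ω f) (p : EuclideanSpace ℝ (Fin d) →L[ℝ] ℝ)
    {e : EuclideanSpace ℝ (Fin d)} (hpe : p e = 1) :
    ∫ x, p x * (2 * f x * fderiv ℝ f x e) = -∫ x, f x ^ 2 := by
  have hfd : Differentiable ℝ f := hf.1.differentiable (by simp)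
  have hsqd : ∀ x, fderiv ℝ (fun y => f y ^ 2) x e = 2 * f x * fderiv ℝ f x e := by
    intro x
    rw [((hfd x).hasFDerivAt.pow 2).fderiv]
    simp
  have hi3 : Integrable fun x => p x * f x ^ 2 :=
    (p.continuous.mul (hf.1.continuous.pow 2)).integrable_of_hasCompactSupport
      (hasCompactSupport_sq hf.2.1).mul_left
  have hparts := integral_mul_fderiv_eq_neg_fderiv_mul_of_integrable (μ := volume) (𝕜 := ℝ)
    (f := p) (g := fun x => f x ^ 2) (v := e)
    (by simpa only [ContinuousLinearMap.fderiv, hpe, one_mul] using hf.integrable_sq)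
    (by simpa only [hsqd] using hf.integrable_mul_fderiv p.continuous e) hi3
    (fun x _ => p.differentiableAt) (fun x _ => (hfd x).pow 2)
  simpa only [hsqd, ContinuousLinearMap.fderiv, hpe, one_mul] using hparts

/-- Poincaré inequality for test functions on a set lying between two hyperplanes. -/
theorem IsTestFunction.integral_sq_le {f : EuclideanSpace ℝ (Fin d) → ℝ}
    (hf : IsTestFunction Ω f) (i : Fin d) {R : ℝ} (hR : ∀ x ∈ Ω, |x i| ≤ R) :
    ∫ x in Ω, f x ^ 2 ≤ 4 * R ^ 2 * ∫ x in Ω, ‖gradient f x‖ ^ 2 := by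
  obtain ⟨e, he, hei⟩ : ∃ e : EuclideanSpace ℝ (Fin d), ‖e‖ = 1 ∧ e i = 1 :=
    ⟨EuclideanSpace.single i 1, by simp, by simp⟩
  obtain ⟨p, hp⟩ : ∃ p : EuclideanSpace ℝ (Fin d) →L[ℝ] ℝ, ∀ x, p x = x i :=
    ⟨EuclideanSpace.proj i, fun x => rfl⟩
  have hsupp : ∀ x, x ∉ Ω → f x = 0 := fun x hx => image_eq_zero_of_notMem_tsupport
    fun h => hx (hf.2.2 h)
  have hsuppg : ∀ x, x ∉ Ω → gradient f x = 0 := fun x hx => by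
    have : fderiv ℝ f x = 0 := image_eq_zero_of_notMem_tsupport
      fun h => hx (hf.2.2 (tsupport_fderiv_subset ℝ h))
    rw [gradient, this, map_zero]
  rw [setIntegral_eq_integral_of_forall_compl_eq_zero (fun x hx => by simp [hsupp x hx]),
    setIntegral_eq_integral_of_forall_compl_eq_zero (fun x hx => by simp [hsuppg x hx])]
  have hi1 := hf.integrable_sq
  have hi2 := hf.integrable_norm_gradient_sq
  have hi4 := hf.integrable_mul_fderiv p.continuous e
  have hparts := hf.integral_mul_fderiv p ((hp e).trans hei)
  have hle : ∫ x, -(p x * (2 * f x * fderiv ℝ f x e))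
      ≤ ∫ x, (1 / 2 * f x ^ 2 + 2 * R ^ 2 * ‖gradient f x‖ ^ 2) := by
    refine integral_mono hi4.neg ((hi1.const_mul _).add (hi2.const_mul _)) fun x => ?_
    simp only
    by_cases hx : x ∈ Ω
    · have h1 : |fderiv ℝ f x e| ≤ ‖gradient f x‖ := by
        have := (fderiv ℝ f x).le_opNorm e
        rwa [he, mul_one, ← norm_gradient_eq, Real.norm_eq_abs] at this
      have h2 : |p x * fderiv ℝ f x e| ≤ R * ‖gradient f x‖ := by
        rw [abs_mul, hp]
        exact mul_le_mul (hR x hx) h1 (abs_nonneg _) ((abs_nonneg _).trans (hR x hx))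
      -- With `q = p ∂_e f`, the square `(f + 2q)² ≥ 0` gives `-2fq ≤ f²/2 + 2q²`. Absorbing `f²/2`
      -- on the left doubles `2R²` to `4R²`.
      have h3 : (p x * fderiv ℝ f x e) ^ 2 ≤ (R * ‖gradient f x‖) ^ 2 := by
        rw [← sq_abs]; exact pow_le_pow_left₀ (abs_nonneg _) h2 2
      have h4 := sq_nonneg (f x + 2 * (p x * fderiv ℝ f x e))
      linarith
    · rw [hsupp x hx, hsuppg x hx]
      simp
  rw [integral_neg, hparts, neg_neg, integral_add (hi1.const_mul _) (hi2.const_mul _),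
    integral_const_mul, integral_const_mul] at hle
  linarith

/-- Dirichlet eigenvalues of a bounded set are positive. -/
theorem SolvesDirichletEigenproblem.pos (hd : 1 ≤ d) (hΩb : Bornology.IsBounded Ω) {μ : ℝ}
    {v : L2 Ω} (hv : SolvesDirichletEigenproblem Ω μ v) (hv0 : v ≠ 0) : 0 < μ := by
  obtain ⟨w, ⟨hvm, hwm, f, hf, hfv, hfw⟩, hweak⟩ := hv
  obtain ⟨R, hR⟩ := hΩb.exists_norm_le
  let i : Fin d := ⟨0, hd⟩
  have hRi : ∀ x ∈ Ω, |x i| ≤ R := fun x hx => (PiLp.norm_apply_le x i).trans (hR x hx)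
  let V : ℕ → L2 Ω := fun n => (hf n).memLp.toLp
  let W : ℕ → Lp (EuclideanSpace ℝ (Fin d)) 2 (volume.restrict Ω) :=
    fun n => (hf n).memLp_gradient.toLp
  have hV : Tendsto V atTop (𝓝 v) := by
    rw [← Lp.toLp_coeFn v hvm]
    exact (Lp.tendsto_Lp_iff_tendsto_eLpNorm'' f (fun n => (hf n).memLp) v hvm).2 hfv
  have hW : Tendsto W atTop (𝓝 (hwm.toLp w)) :=
    (Lp.tendsto_Lp_iff_tendsto_eLpNorm'' (fun n => gradient (f n))
      (fun n => (hf n).memLp_gradient) w hwm).2 hfw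
  have hnormsq : ∀ n, ‖V n‖ ^ 2 ≤ 4 * R ^ 2 * ‖W n‖ ^ 2 := by
    intro n
    rw [← real_inner_self_eq_norm_sq, ← real_inner_self_eq_norm_sq, L2.inner_def, L2.inner_def]
    convert (hf n).integral_sq_le i hRi using 1
    · refine integral_congr_ae ?_
      filter_upwards [(hf n).memLp.coeFn_toLp] with x hx
      rw [hx, real_inner_self_eq_norm_sq, Real.norm_eq_abs, sq_abs]
    · congr 1
      refine integral_congr_ae ?_
      filter_upwards [(hf n).memLp_gradient.coeFn_toLp] with x hx
      rw [hx, real_inner_self_eq_norm_sq]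
  have hpoinc : ‖v‖ ^ 2 ≤ 4 * R ^ 2 * ‖hwm.toLp w‖ ^ 2 :=
    le_of_tendsto_of_tendsto' (hV.norm.pow 2) ((hW.norm.pow 2).const_mul _) hnormsq
  have hinner : ∀ n, ⟪hwm.toLp w, W n⟫ = μ * ⟪v, V n⟫ := by
    intro n
    rw [L2.inner_def, L2.inner_def]
    convert hweak (f n) (hf n) using 1
    · refine integral_congr_ae ?_
      filter_upwards [(hf n).memLp_gradient.coeFn_toLp, hwm.coeFn_toLp] with x hx hx'
      rw [hx, hx']
    · congr 1
      refine integral_congr_ae ?_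
      filter_upwards [(hf n).memLp.coeFn_toLp] with x hx
      rw [hx]
      simp [mul_comm]
  -- The weak equation tested with the approximating `f n`, in the limit. With Poincaré, `μ ≤ 0`
  -- would force `v = 0`.
  have henergy : ‖hwm.toLp w‖ ^ 2 = μ * ‖v‖ ^ 2 := by
    rw [← real_inner_self_eq_norm_sq, ← real_inner_self_eq_norm_sq]
    refine tendsto_nhds_unique (tendsto_const_nhds.inner hW) ?_
    simp only [hinner]
    exact (tendsto_const_nhds.inner hV).const_mul μ
  have hvpos : 0 < ‖v‖ ^ 2 := by positivity
  rw [henergy] at hpoinc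
  by_contra hμ
  have : μ * ‖v‖ ^ 2 ≤ 0 := mul_nonpos_of_nonpos_of_nonneg (not_lt.1 hμ) hvpos.le
  nlinarith [sq_nonneg R]

end Poincare

/-! ### Second moment of the data error -/

section Observation

variable {H S : Type*} [NormedAddCommGroup H] [InnerProductSpace ℝ H] [MeasurableSpace S]
  {P : Measure S} (φ : HilbertBasis ℕ ℝ H) (ξ : H →L[ℝ] Lp ℝ 2 P) (g : H) (δ : ℝ) (N : ℕ)

theorem inner_observedData (ω : S) (i : ℕ) :
    ⟪observedData φ ξ g δ N ω, φ i⟫ = if i < N then observation ξ g δ (φ i) ω else 0 := by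
  simp only [observedData, sum_inner, real_inner_smul_left,
    orthonormal_iff_ite.1 φ.orthonormal, mul_ite, mul_one, mul_zero, Finset.sum_ite_eq',
    Finset.mem_range]

/-- Parseval: the coefficients of the error are `-δ ξ (φ j)` for `j < N` and those of `g` from `N`
on. No cross terms arise, so the expectation only needs `E (ξ (φ j))² = 1`. -/
theorem norm_sub_observedData_sq (ω : S) :
    ‖g - observedData φ ξ g δ N ω‖ ^ 2 =
      ∑ j ∈ Finset.range N, δ ^ 2 * (ξ (φ j) ω * ξ (φ j) ω) + ∑' j, ⟪g, φ (j + N)⟫ ^ 2 := by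
  have h := hasSum_coeff_sq φ (g - observedData φ ξ g δ N ω)
  rw [← h.tsum_eq, ← h.summable.sum_add_tsum_nat_add N]
  congr 1
  · refine Finset.sum_congr rfl fun j hj => ?_
    rw [inner_sub_left, inner_observedData, if_pos (Finset.mem_range.1 hj), observation]
    ring
  · refine tsum_congr fun j => ?_
    rw [inner_sub_left, inner_observedData, if_neg (by omega), sub_zero]

theorem aestronglyMeasurable_observedData :
    AEStronglyMeasurable (observedData φ ξ g δ N) P := by
  unfold observedData observation
  exact Finset.aestronglyMeasurable_fun_sum _ fun j _ => AEStronglyMeasurable.smul_const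
    (((Lp.aestronglyMeasurable (ξ (φ j))).const_mul δ).const_add _) _

theorem integrable_mul_self (χ : H) : Integrable (fun ω => ξ χ ω * ξ χ ω) P := by
  simpa only [sq] using (Lp.memLp (ξ χ)).integrable_sq

theorem integrable_norm_sub_observedData_sq [IsFiniteMeasure P] :
    Integrable (fun ω => ‖g - observedData φ ξ g δ N ω‖ ^ 2) P := by
  simp only [norm_sub_observedData_sq]
  exact (integrable_finsetSum _ fun j _ => (integrable_mul_self ξ (φ j)).const_mul _).add
    (integrable_const _)

theorem integral_norm_sub_observedData_sq [IsProbabilityMeasure P]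
    (hξ : IsGaussianWhiteNoise P ξ) :
    ∫ ω, ‖g - observedData φ ξ g δ N ω‖ ^ 2 ∂P = δ ^ 2 * N + ∑' j, ⟪g, φ (j + N)⟫ ^ 2 := by
  simp only [norm_sub_observedData_sq]
  have hi : ∀ j ∈ Finset.range N, Integrable (fun ω => δ ^ 2 * (ξ (φ j) ω * ξ (φ j) ω)) P :=
    fun j _ => (integrable_mul_self ξ (φ j)).const_mul _
  rw [integral_add (integrable_finsetSum _ hi) (integrable_const _), integral_finsetSum _ hi]
  simp [integral_const_mul, hξ.cov, φ.orthonormal.1, mul_comm]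

/-- By monotonicity each tail weight is at least that of `lam (N - 1)`, the `N`-th eigenvalue when
counting from 1. At `N = 0` the subtraction truncates to `lam 0`, and the comparison still holds. -/
theorem tsum_coeff_tail_le {lam : ℕ → ℝ} (hpos : ∀ j, 0 < lam j) (hmono : Monotone lam) {γ : ℝ}
    (hγ : 0 ≤ γ) (hg : MemSobolev lam φ (2 * γ) g) :
    ∑' j, ⟪g, φ (j + N)⟫ ^ 2 ≤ sobolevNormSq lam φ (2 * γ) g / lam (N - 1) ^ (2 * γ) := by
  have hl : 0 < lam (N - 1) ^ (2 * γ) := Real.rpow_pos_of_pos (hpos _) _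
  have hnn : ∀ j, 0 ≤ lam j ^ (2 * γ) * ⟪g, φ j⟫ ^ 2 := fun j =>
    mul_nonneg (Real.rpow_nonneg (hpos j).le _) (sq_nonneg _)
  have hs := (summable_nat_add_iff N).2 (hasSum_coeff_sq φ g).summable
  have hs' := (summable_nat_add_iff N).2 hg
  rw [le_div_iff₀ hl, mul_comm, ← tsum_mul_left]
  calc ∑' j, lam (N - 1) ^ (2 * γ) * ⟪g, φ (j + N)⟫ ^ 2
      ≤ ∑' j, lam (j + N) ^ (2 * γ) * ⟪g, φ (j + N)⟫ ^ 2 := by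
        refine (hs.mul_left _).tsum_le_tsum (fun j => ?_) hs'
        exact mul_le_mul_of_nonneg_right (Real.rpow_le_rpow (hpos _).le (hmono (by omega))
          (by positivity)) (sq_nonneg _)
    _ ≤ sobolevNormSq lam φ (2 * γ) g := by
        rw [sobolevNormSq, ← Summable.sum_add_tsum_nat_add N hg]
        exact le_add_of_nonneg_left (Finset.sum_nonneg fun j _ => hnn j)

end Observation

/-! ### Dependence on the data and the mean square estimate -/

section Estimate

variable {H : Type*} [NormedAddCommGroup H] [InnerProductSpace ℝ H] (φ : HilbertBasis ℕ ℝ H)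
  {lam : ℕ → ℝ}

/-- Only modes with `lam j > α` remain, and there `e^{2tα} α^{2β}` is at most the weight in the sum.
-/
theorem exp_mul_norm_sub_truncatedGroup_sq_le (hlam : ∀ j, 0 ≤ lam j) {α β t A : ℝ} (hα : 0 < α)
    (hβ : 0 ≤ β) (ht : 0 ≤ t) {u : H}
    (hs : Summable fun j => lam j ^ (2 * β) * Real.exp (2 * t * lam j) * ⟪u, φ j⟫ ^ 2)
    (hA : ∑' j, lam j ^ (2 * β) * Real.exp (2 * t * lam j) * ⟪u, φ j⟫ ^ 2 ≤ A) :
    Real.exp (2 * t * α) * ‖u - truncatedGroup φ hlam α 0 u‖ ^ 2 ≤ A * α ^ (-2 * β) := by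
  have hαβ : 0 < α ^ (2 * β) := Real.rpow_pos_of_pos hα _
  rw [neg_mul, Real.rpow_neg hα.le, ← div_eq_mul_inv, le_div_iff₀ hαβ, mul_right_comm]
  refine le_trans ?_ hA
  refine hasSum_le (fun j => ?_) ((hasSum_coeff_sq φ (u - truncatedGroup φ hlam α 0 u)).mul_left
    (Real.exp (2 * t * α) * α ^ (2 * β))) hs.hasSum
  rw [inner_sub_left, inner_truncatedGroup]
  by_cases hj : lam j ≤ α
  · rw [truncatedExp_of_le hj]
    simp only [zero_mul, Real.exp_zero, one_mul, sub_self, ne_eq, OfNat.ofNat_ne_zero,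
      not_false_eq_true, zero_pow, mul_zero]
    exact mul_nonneg (mul_nonneg (Real.rpow_nonneg (hlam j) _) (Real.exp_pos _).le) (sq_nonneg _)
  · rw [truncatedExp_of_not_le hj, zero_mul, sub_zero, mul_comm (Real.exp _)]
    have hj' : α ≤ lam j := (not_le.1 hj).le
    have hj0 : 0 ≤ lam j ^ (2 * β) := Real.rpow_nonneg (hlam j) _
    gcongr

variable [CompleteSpace H] {T k : ℝ} {Q : ℝ → H → H}

theorem norm_sub_sq_le_of_isMildSolution_truncation (hlam : ∀ j, 0 ≤ lam j) (α : ℝ)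
    (hLip : ∀ s ∈ Icc 0 T, ∀ w w', ‖Q s w - Q s w'‖ ≤ k * ‖w - w'‖)
    (hint : ∀ v : ℝ → H, ContinuousOn v (Icc 0 T) → IntegrableOn (fun s => Q s (v s)) (Icc 0 T))
    {G G' : H} {v v' : ℝ → H}
    (hv : IsMildSolution T lam φ (fun s w => truncation lam φ α (Q s w)) (truncation lam φ α G) v)
    (hv' : IsMildSolution T lam φ (fun s w => truncation lam φ α (Q s w))
      (truncation lam φ α G') v') {t : ℝ} (ht : t ∈ Icc 0 T) :
    Real.exp (2 * t * α) * ‖v t - v' t‖ ^ 2 ≤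
      2 * Real.exp (2 * T * α) * ‖G - G'‖ ^ 2 * Real.exp (2 * k ^ 2 * T * (T - t)) := by
  obtain ⟨hvc, hvj⟩ := (isMildSolution_truncation_iff φ hlam α).1 hv
  have h := exp_mul_norm_sub_sq_le φ hlam α (B := 0) (g := G) hLip hint hvc
    (fun t ht j hj => by simpa [truncatedExp_of_le hj] using hvj t ht j) hv'
    (fun t ht => by
      -- A truncated solution is fixed by `J_α`, which is idempotent, so stability applies with no
      -- high-frequency part, `B = 0`.
      have h0 : v t = truncatedGroup φ hlam α 0 (v t) := ext_coeff φ fun j => by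
        rw [inner_truncatedGroup, hvj t ht j, ← mul_assoc, ← truncatedExp_add, add_zero]
      rw [← h0]; simp) ht
  rwa [zero_add] at h

theorem eqOn_of_isMildSolution_truncation (hlam : ∀ j, 0 ≤ lam j) (α : ℝ)
    (hLip : ∀ s ∈ Icc 0 T, ∀ w w', ‖Q s w - Q s w'‖ ≤ k * ‖w - w'‖)
    (hint : ∀ v : ℝ → H, ContinuousOn v (Icc 0 T) → IntegrableOn (fun s => Q s (v s)) (Icc 0 T))
    {G : H} {v v' : ℝ → H}
    (hv : IsMildSolution T lam φ (fun s w => truncation lam φ α (Q s w)) (truncation lam φ α G) v)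
    (hv' : IsMildSolution T lam φ (fun s w => truncation lam φ α (Q s w))
      (truncation lam φ α G) v') : EqOn v v' (Icc 0 T) := by
  intro t ht
  have h := norm_sub_sq_le_of_isMildSolution_truncation φ hlam α hLip hint hv hv' ht
  simp only [sub_self, norm_zero, ne_eq, OfNat.ofNat_ne_zero, not_false_eq_true, zero_pow,
    mul_zero, zero_mul] at h
  have h1 : ‖v t - v' t‖ ^ 2 ≤ 0 := nonpos_of_mul_nonpos_right h (Real.exp_pos _)
  exact sub_eq_zero.1 (norm_eq_zero.1 (pow_eq_zero_iff two_ne_zero |>.1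
    (le_antisymm h1 (sq_nonneg _))))

/-- Solutions of the truncated problem depend measurably on the noise. -/
theorem aestronglyMeasurable_of_isMildSolution_truncation {S : Type*} [MeasurableSpace S]
    {P : Measure S} (hlam : ∀ j, 0 ≤ lam j) (α : ℝ) (hT : 0 ≤ T) (hk : 0 ≤ k)
    (hLip : ∀ s ∈ Icc 0 T, ∀ w w', ‖Q s w - Q s w'‖ ≤ k * ‖w - w'‖)
    (hint : ∀ v : ℝ → H, ContinuousOn v (Icc 0 T) → IntegrableOn (fun s => Q s (v s)) (Icc 0 T))
    {G : S → H} (hG : AEStronglyMeasurable G P) {U : S → ℝ → H}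
    (hU : ∀ᵐ ω ∂P, IsMildSolution T lam φ (fun s w => truncation lam φ α (Q s w))
      (truncation lam φ α (G ω)) (U ω)) {t : ℝ} (ht : t ∈ Icc 0 T) :
    AEStronglyMeasurable (fun ω => U ω t) P := by
  -- An arbitrary choice of solution map suffices: stability makes it Lipschitz in the data at time
  -- `t`, and uniqueness identifies it almost surely with `U`.
  choose Φ hΦ using exists_isMildSolution_truncation φ hlam α hT hk hLip hint
  set K := 2 * Real.exp (2 * T * α) * Real.exp (2 * k ^ 2 * T * (T - t)) / Real.exp (2 * t * α)
    with hK
  have hcont : Continuous fun G => Φ G t := by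
    refine (LipschitzWith.of_dist_le_mul (K := ⟨√K, Real.sqrt_nonneg K⟩) fun G G' => ?_).continuous
    rw [dist_eq_norm, dist_eq_norm]
    change _ ≤ √K * _
    refine (sq_le_sq₀ (norm_nonneg _) (by positivity)).1 ?_
    rw [mul_pow, Real.sq_sqrt (by positivity), hK, div_mul_eq_mul_div,
      le_div_iff₀ (Real.exp_pos _)]
    linarith [norm_sub_sq_le_of_isMildSolution_truncation φ hlam α hLip hint (hΦ G) (hΦ G') ht]
  refine (hcont.comp_aestronglyMeasurable hG).congr ?_
  filter_upwards [hU] with ω hω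
  exact eqOn_of_isMildSolution_truncation φ hlam α hLip hint (hΦ _) hω ht

theorem memLp_and_integral_norm_sub_sq_le {S : Type*} [MeasurableSpace S]
    {P : Measure S} [IsProbabilityMeasure P] {ξ : H →L[ℝ] Lp ℝ 2 P}
    (hξ : IsGaussianWhiteNoise P ξ) (hpos : ∀ j, 0 < lam j) (hmono : Monotone lam) (hk : 0 ≤ k)
    (hLip : ∀ s ∈ Icc 0 T, ∀ w w', ‖Q s w - Q s w'‖ ≤ k * ‖w - w'‖)
    (hint : ∀ v : ℝ → H, ContinuousOn v (Icc 0 T) → IntegrableOn (fun s => Q s (v s)) (Icc 0 T))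
    {g : H} {u : ℝ → H} (hu : IsMildSolution T lam φ Q g u) {α β γ A δ : ℝ} (hβ : 0 ≤ β)
    (hγ : 0 ≤ γ) (hg : MemSobolev lam φ (2 * γ) g)
    (hA : ∀ t ∈ Icc 0 T,
      Summable (fun j => lam j ^ (2 * β) * Real.exp (2 * t * lam j) * ⟪u t, φ j⟫ ^ 2) ∧
      ∑' j, lam j ^ (2 * β) * Real.exp (2 * t * lam j) * ⟪u t, φ j⟫ ^ 2 < A)
    {N : ℕ} (hα : 0 < α) {U : S → ℝ → H}
    (hU : ∀ᵐ ω ∂P, IsMildSolution T lam φ (fun s w => truncation lam φ α (Q s w))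
      (truncation lam φ α (observedData φ ξ g δ N ω)) (U ω)) {t : ℝ} (ht : t ∈ Icc 0 T) :
    MemLp (fun ω => u t - U ω t) 2 P ∧ ∫ ω, ‖u t - U ω t‖ ^ 2 ∂P ≤
      errorBound k T t δ A β γ N (lam (N - 1)) α (sobolevNormSq lam φ (2 * γ) g) := by
  have hlam : ∀ j, 0 ≤ lam j := fun j => (hpos j).le
  have hT : 0 ≤ T := ht.1.trans ht.2
  have hA0 : 0 ≤ A := by
    refine le_trans (tsum_nonneg fun j => ?_) (hA t ht).2.le
    exact mul_nonneg (mul_nonneg (Real.rpow_nonneg (hlam j) _) (Real.exp_pos _).le) (sq_nonneg _)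
  set B := A * α ^ (-2 * β) with hB
  have hB0 : 0 ≤ B := mul_nonneg hA0 (Real.rpow_nonneg hα.le _)
  set L := Real.exp (2 * k ^ 2 * T * (T - t)) * Real.exp (-2 * t * α) with hL
  have hmeas : AEStronglyMeasurable (fun ω => u t - U ω t) P :=
    aestronglyMeasurable_const.sub (aestronglyMeasurable_of_isMildSolution_truncation φ hlam α hT
      hk hLip hint (aestronglyMeasurable_observedData φ ξ g δ N) hU ht)
  have hpath : ∀ᵐ ω ∂P, ‖u t - U ω t‖ ^ 2 ≤
      L * (B + 2 * Real.exp (2 * T * α) * ‖g - observedData φ ξ g δ N ω‖ ^ 2) := by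
    filter_upwards [hU] with ω hω
    have h := exp_mul_norm_sub_sq_le φ hlam α hLip hint hu.1
      (fun t ht j _ => (hasSum_smul_basis_iff φ).1 (hu.2 t ht) j) hω
      (fun t ht => exp_mul_norm_sub_truncatedGroup_sq_le φ hlam hα hβ ht.1 (hA t ht).1
        (hA t ht).2.le) ht
    have h2 := mul_le_mul_of_nonneg_left h (Real.exp_pos (-2 * t * α)).le
    rw [← mul_assoc, ← Real.exp_add, show -2 * t * α + 2 * t * α = 0 by ring, Real.exp_zero,
      one_mul] at h2
    refine h2.trans_eq ?_
    rw [hL, hB]; ring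
  have hGi := integrable_norm_sub_observedData_sq φ ξ g δ N
  have hbi : Integrable (fun ω => L * (B + 2 * Real.exp (2 * T * α) *
      ‖g - observedData φ ξ g δ N ω‖ ^ 2)) P :=
    ((integrable_const _).add (hGi.const_mul _)).const_mul _
  have hsqi : Integrable (fun ω => ‖u t - U ω t‖ ^ 2) P := by
    refine hbi.mono' (hmeas.norm.pow 2) ?_
    filter_upwards [hpath] with ω hω
    rwa [Real.norm_of_nonneg (sq_nonneg _)]
  refine ⟨(memLp_two_iff_integrable_sq_norm hmeas).2 hsqi,
    (integral_mono_ae hsqi hbi hpath).trans ?_⟩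
  rw [integral_const_mul, integral_add (integrable_const _) (hGi.const_mul _),
    integral_const, integral_const_mul, integral_norm_sub_observedData_sq φ ξ g δ N hξ,
    probReal_univ, one_smul, errorBound]
  have htail := tsum_coeff_tail_le φ g N hpos hmono hγ hg
  set τ := ∑' j, ⟪g, φ (j + N)⟫ ^ 2
  rw [mul_assoc 2 (Real.exp _) (Real.exp _), ← hL, ← hB, mul_comm 2 L, mul_assoc L 2]
  refine mul_le_mul_of_nonneg_left ?_ (by positivity)
  -- The factor 2 belongs to the data terms; the high-frequency term `B` occurs once and is enlarged
  -- to `2B` using `B ≥ 0`.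
  have h3 := mul_le_mul_of_nonneg_left htail (Real.exp_pos (2 * T * α)).le
  rw [← mul_div_assoc] at h3
  rw [div_mul_eq_mul_div]
  linarith

end Estimate

end BackwardHeat

/-! ### The main theorem -/

theorem mainTheorem1
    {d : ℕ} (hd : 1 ≤ d) (Ω : Set (EuclideanSpace ℝ (Fin d))) (hΩ : IsOpen Ω)
    (hΩb : Bornology.IsBounded Ω)
    (lam : ℕ → ℝ) (φ : HilbertBasis ℕ ℝ (L2 Ω)) (hφ : IsDirichletEigenbasis Ω lam φ)
    (T : ℝ) (hT : 0 < T)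
    (F : EuclideanSpace ℝ (Fin d) → ℝ → ℝ → ℝ) (k : ℝ) (hk : 0 ≤ k)
    (hFmeas : ∀ z : ℝ, Measurable fun p : EuclideanSpace ℝ (Fin d) × ℝ => F p.1 p.2 z)
    (hFLip : ∀ x ∈ Ω, ∀ t ∈ Icc 0 T, ∀ z z' : ℝ, |F x t z - F x t z'| ≤ k * |z - z'|)
    (hF0 : MemLp (fun p : EuclideanSpace ℝ (Fin d) × ℝ => F p.1 p.2 0) 2
      ((volume.restrict Ω).prod (volume.restrict (Icc 0 T))))
    (g : L2 Ω)
    {S : Type*} [MeasurableSpace S] (P : Measure S) [IsProbabilityMeasure P]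
    (ξ : L2 Ω →L[ℝ] Lp ℝ 2 P) (hξ : IsGaussianWhiteNoise P ξ)
    (N : ℝ → ℕ) (α : ℝ → ℝ) :
    -- the regularized problem has a unique solution, and it is given by the truncated series
    (∀ δ > 0, ∀ ω : S, ∃ v : ℝ → L2 Ω,
      IsRegularizedSolution T lam φ F (α δ) (observedData φ ξ g δ (N δ) ω) v ∧
      (∀ v' : ℝ → L2 Ω,
        IsRegularizedSolution T lam φ F (α δ) (observedData φ ξ g δ (N δ) ω) v' →
          EqOn v' v (Icc 0 T)) ∧
      ∀ t ∈ Icc 0 T, HasSum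
        (fun j : {j : ℕ // lam j ≤ α δ} =>
          mildCoeff T lam φ (superposition Ω F) (observedData φ ξ g δ (N δ) ω) v t j • φ j)
        (v t)) ∧
    -- the error estimate
    ∀ (u : ℝ → L2 Ω), IsMildSolution T lam φ (superposition Ω F) g u →
      ∀ (β γ A : ℝ), 0 ≤ β → 0 ≤ γ → MemSobolev lam φ (2 * γ) g →
      (∀ t ∈ Icc 0 T,
        Summable (fun j => lam j ^ (2 * β) * Real.exp (2 * t * lam j) * ⟪u t, φ j⟫ ^ 2) ∧
        ∑' j, lam j ^ (2 * β) * Real.exp (2 * t * lam j) * ⟪u t, φ j⟫ ^ 2 < A) →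
      -- for every noise level with at least one observation and a positive parameter
      (∀ δ > 0, 1 ≤ N δ → 0 < α δ → ∀ U : S → ℝ → L2 Ω,
        (∀ᵐ ω ∂P,
          IsRegularizedSolution T lam φ F (α δ) (observedData φ ξ g δ (N δ) ω) (U ω)) →
        ∀ t ∈ Icc 0 T, MemLp (fun ω => u t - U ω t) 2 P ∧
          ∫ ω, ‖u t - U ω t‖ ^ 2 ∂P ≤
            errorBound k T t δ A β γ (N δ) (lam (N δ - 1)) (α δ)
              (sobolevNormSq lam φ (2 * γ) g)) ∧
      -- in particular, for all small noise levels under the growth conditions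
      (Tendsto α (𝓝[>] 0) atTop →
        Tendsto (fun δ => Real.exp (k * T * α δ) / lam (N δ - 1) ^ γ) (𝓝[>] 0) (𝓝 0) →
        Tendsto (fun δ => Real.exp (k * T * α δ) * Real.sqrt (N δ) * δ) (𝓝[>] 0) (𝓝 0) →
        ∀ᶠ δ in 𝓝[>] (0 : ℝ), 1 ≤ N δ ∧ 0 < α δ ∧ ∀ U : S → ℝ → L2 Ω,
          (∀ᵐ ω ∂P,
            IsRegularizedSolution T lam φ F (α δ) (observedData φ ξ g δ (N δ) ω) (U ω)) →
          ∀ t ∈ Icc 0 T, MemLp (fun ω => u t - U ω t) 2 P ∧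
            ∫ ω, ‖u t - U ω t‖ ^ 2 ∂P ≤
              errorBound k T t δ A β γ (N δ) (lam (N δ - 1)) (α δ)
                (sobolevNormSq lam φ (2 * γ) g)) := by
  have hpos : ∀ j, 0 < lam j := fun j =>
    (hφ.eigen j).pos hd hΩb (φ.orthonormal.ne_zero j)
  have hlam : ∀ j, 0 ≤ lam j := fun j => (hpos j).le
  have hLip := norm_superposition_sub_le hΩ.measurableSet hk hFmeas hFLip
  have hint := integrableOn_superposition φ hΩ.measurableSet hT.le hk hFmeas hFLip hF0
  refine ⟨fun δ _ ω => ?_, fun u hu β γ A hβ hγ hg hA => ?_⟩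
  · obtain ⟨v, hv⟩ := exists_isMildSolution_truncation φ hlam (α δ) hT.le hk hLip hint
      (observedData φ ξ g δ (N δ) ω)
    exact ⟨v, hv, fun v' hv' => eqOn_of_isMildSolution_truncation φ hlam (α δ) hLip hint hv' hv,
      fun t ht => hasSum_subtype_of_isMildSolution_truncation φ hlam (α δ) hv ht⟩
  have hmain : ∀ δ : ℝ, 0 < α δ → ∀ U : S → ℝ → L2 Ω,
      (∀ᵐ ω ∂P,
        IsRegularizedSolution T lam φ F (α δ) (observedData φ ξ g δ (N δ) ω) (U ω)) →
      ∀ t ∈ Icc 0 T, MemLp (fun ω => u t - U ω t) 2 P ∧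
        ∫ ω, ‖u t - U ω t‖ ^ 2 ∂P ≤
          errorBound k T t δ A β γ (N δ) (lam (N δ - 1)) (α δ)
            (sobolevNormSq lam φ (2 * γ) g) := fun δ hα U hU t ht =>
    memLp_and_integral_norm_sub_sq_le φ hξ hpos hφ.mono hk hLip hint hu hβ hγ hg hA hα hU ht
  refine ⟨fun δ _ _ hα => hmain δ hα, fun hα hγlim _ => ?_⟩
  have hl0 : 0 < lam 0 ^ γ := Real.rpow_pos_of_pos (hpos 0) γ
  -- If `N δ = 0`, then `lam (N δ - 1)` is `lam 0` and, as `e^{kTα} ≥ 1`, the ratio is at least `1 /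
  -- lam 0 ^ γ`; this threshold therefore forces `N δ ≥ 1`.
  filter_upwards [hα.eventually_gt_atTop 0, hγlim.eventually_lt_const (one_div_pos.2 hl0)]
    with δ hαδ hδ
  refine ⟨Nat.one_le_iff_ne_zero.2 fun hN => ?_, hαδ, hmain δ hαδ⟩
  rw [hN, Nat.zero_sub, div_lt_div_iff_of_pos_right hl0] at hδ
  exact hδ.not_ge (Real.one_le_exp (by positivity))
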